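/- Let $K$ be a field, $R=K[x_1,\dots,x_n]$, $a\in\mathbb N^n$, and let $I\subseteq R$ be a monomial ideal with set of minimal monomial generators $G(I)$. Assume that $I$ is strongly stable (if $m\in I$ is a monomial, $x_i\mid m$ and $j<i$, then $mx_j/x_i\in I$), that all elements of $G(I)$ have degree $d$, and that $I$ is $a$-determined (every $f\in G(I)$ divides $x^a$). Put $\widehat f=x^a/f$ for $f\in G(I)$ and let $\widehat I^{[a]}=(\widehat f\mid f\in G(I))$. Identify monomials with their exponent vectors in $\mathbb N^n\subset\mathbb R^n$. For a monomial $m$ put $\operatorname{supp}_1(m)=\{i\ge 2 : x_i\mid m\}$, and for $\sigma\subseteq\operatorname{supp}_1(m)$ let $m\to\sigma$ be the monomial $m\prod_{i\in\sigma}x_{i-1}/x_i$ and $C(m,\sigma)\subset\mathbb R^n$ the convex hull of $\{m\to\tau\mid\tau\subseteq\sigma\}$. Let $X_I$ consist of the empty cell and all $C(m,\sigma)$ with $m\in G(I)$ and $\sigma\subseteq\operatorname{supp}_1(m)$. Label the vertex $f\in G(I)$ by $\widehat f$ and every cell $P$ by the least common multiple $x^{\alpha_P}$ of the labels of its vertices.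 Then: 1. $X_I$ is a polyhedral cell complex. For $m\in G(I)$ and $\sigma\subseteq\operatorname{supp}_1(m)$, all $m\to\tau$ with $\tau\subseteq\sigma$ lie in $G(I)$, the cell $C(m,\sigma)$ has dimension $|\sigma|$ and label $\widehat m\prod_{j\in\sigma}x_j$, and distinct pairs $(m,\sigma)$ give distinct cells. 2. The following signs define an incidence function $\varepsilon$ on $X_I$: if $\sigma=\{i_1<\dots<i_k\}$, then $\varepsilon(C(m,\sigma\setminus\{i_t\}),C(m,\sigma))=(-1)^{t-1}$ and, for the parallel facet, $\varepsilon(C(m\to\{i_t\},\sigma\setminus\{i_t\}),C(m,\sigma))=-(-1)^{t-1}$; moreover $\varepsilon(\emptyset,v)=1$ for every vertex $v$. 3. The cellular free complex $\mathcal F_{X_I}$, which has in homological degree $k$ the free module $\bigoplus_{\dim P=k-1}R(-\alpha_P)$ and the differential $\partial(P)=\sum_{Q\text{ facet of }P}\varepsilon(Q,P)\,x^{\alpha_P-\alpha_Q}\,Q$, is an $\mathbb N^n$-graded free resolution of $R/\widehat I^{[a]}$ by modules of finite rank. If $\widehat I^{[a]}\neq R$, this resolution is minimal. -/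

import Mathlib

open Finset MvPolynomial

noncomputable section

namespace CellularDual

/-! ## Monomial ideals

The variables `x_1, …, x_n` are indexed by `Fin n`, so `x_1` is the variable with index value `0`.
Monomials are identified with their exponent vectors in `Fin n →₀ ℕ`. -/

section MonomialIdeals

variable {K : Type*} [Field K] {n : ℕ}

/-- `I` is generated by monomials. -/
def IsMonomialIdeal (I : Ideal (MvPolynomial (Fin n) K)) : Prop :=
  ∃ S : Set (Fin n →₀ ℕ), I = Ideal.span ((fun m => monomial m (1 : K)) '' S)

/-- The set `G(I)` of minimal monomial generators: the monomials of `I` that are minimal for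
divisibility. -/
def minGens (I : Ideal (MvPolynomial (Fin n) K)) : Set (Fin n →₀ ℕ) :=
  {m | Minimal (fun m' : Fin n →₀ ℕ => monomial m' (1 : K) ∈ I) m}

/-- For every monomial `m ∈ I`, every `x_i` dividing `m` and every `j < i`, the monomial
`m x_j / x_i` is in `I`. -/
def IsStronglyStable (I : Ideal (MvPolynomial (Fin n) K)) : Prop :=
  ∀ m : Fin n →₀ ℕ, monomial m (1 : K) ∈ I → ∀ i ∈ m.support, ∀ j < i,
    monomial (m + Finsupp.single j 1 - Finsupp.single i 1) (1 : K) ∈ I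

/-- All minimal monomial generators have degree `d`. -/
def GeneratedInDegree (I : Ideal (MvPolynomial (Fin n) K)) (d : ℕ) : Prop :=
  ∀ m ∈ minGens I, m.degree = d

/-- Every minimal monomial generator divides `x^a`. -/
def IsDetermined (I : Ideal (MvPolynomial (Fin n) K)) (a : Fin n →₀ ℕ) : Prop :=
  ∀ m ∈ minGens I, m ≤ a

/-- The generalized Newton complementary dual: the ideal generated by the monomials `x^a / f`,
`f ∈ G(I)`. -/
def dualIdeal (I : Ideal (MvPolynomial (Fin n) K)) (a : Fin n →₀ ℕ) :
    Ideal (MvPolynomial (Fin n) K) :=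
  Ideal.span ((fun m => monomial (a - m) (1 : K)) '' minGens I)

end MonomialIdeals

/-! ## Free resolutions -/

section Resolutions

variable {R : Type*} [CommRing R] {F : ℕ → Type*} [∀ k, AddCommGroup (F k)]
  [∀ k, Module R (F k)] {M : Type*} [AddCommGroup M] [Module R M]

/-- `⋯ → F 2 → F 1 → F 0 → M → 0` is exact and all `F k` are free of finite rank. -/
structure IsFreeResolution (d : ∀ k, F (k + 1) →ₗ[R] F k) (π : F 0 →ₗ[R] M) : Prop where
  free : ∀ k, Module.Free R (F k)
  finite : ∀ k, Module.Finite R (F k)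
  exact_succ : ∀ k, Function.Exact (d (k + 1)) (d k)
  exact_zero : Function.Exact (d 0) π
  surjective : Function.Surjective π

end Resolutions

/-- Minimality of a complex of free modules over a polynomial ring: the image of every
differential lies in `(x_1, …, x_n)` times its target. -/
def IsMinimalComplex {K : Type*} [Field K] {n : ℕ} {F : ℕ → Type*} [∀ k, AddCommGroup (F k)]
    [∀ k, Module (MvPolynomial (Fin n) K) (F k)]
    (d : ∀ k, F (k + 1) →ₗ[MvPolynomial (Fin n) K] F k) : Prop :=
  ∀ k, LinearMap.range (d k) ≤
    Ideal.span (Set.range (X : Fin n → MvPolynomial (Fin n) K)) •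
      (⊤ : Submodule (MvPolynomial (Fin n) K) (F k))

/-! ## Labeled polyhedral cell complexes and their cellular free complexes -/

section Cellular

variable {n : ℕ}

/-- A polyhedral cell complex in `ℝⁿ`: a finite set of polytopes, closed under passing to faces
(the empty set is a face of every polytope, so it is a cell), in which any two cells meet in a
common face. -/
structure IsPolyhedralComplex (X : Set (Set (Fin n → ℝ))) : Prop where
  finite : X.Finite
  empty_mem : ∅ ∈ X
  polytope : ∀ P ∈ X, ∃ s : Finset (Fin n → ℝ), P = convexHull ℝ (s : Set (Fin n → ℝ))
  face_mem : ∀ P ∈ X, ∀ F : Set (Fin n → ℝ), IsExposed ℝ P F → F ∈ X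
  inter_face : ∀ P ∈ X, ∀ Q ∈ X, IsExposed ℝ P (P ∩ Q) ∧ IsExposed ℝ Q (P ∩ Q)

open Classical in
/-- The dimension of a cell; the empty cell has dimension `-1`. -/
def cellDim (P : Set (Fin n → ℝ)) : ℤ :=
  if P = ∅ then -1 else (Module.finrank ℝ (vectorSpan ℝ P) : ℤ)

/-- The cell `Q` is a facet of the cell `P` (both cells of a fixed complex). -/
def IsFacet (Q P : Set (Fin n → ℝ)) : Prop :=
  Q ⊆ P ∧ cellDim P = cellDim Q + 1

/-- An incidence function `ε(Q, P)` on a polyhedral cell complex. -/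
structure IsIncidenceFunction (X : Set (Set (Fin n → ℝ)))
    (ε : Set (Fin n → ℝ) → Set (Fin n → ℝ) → ℤ) : Prop where
  facet : ∀ P ∈ X, ∀ Q ∈ X, IsFacet Q P → ε Q P = 1 ∨ ε Q P = -1
  not_facet : ∀ P ∈ X, ∀ Q ∈ X, ¬ IsFacet Q P → ε Q P = 0
  vertex : ∀ P ∈ X, cellDim P = 0 → ε ∅ P = 1
  diamond : ∀ P ∈ X, ∀ Q₁ ∈ X, ∀ Q₂ ∈ X, ∀ S ∈ X, Q₁ ≠ Q₂ →
    IsFacet Q₁ P → IsFacet Q₂ P → IsFacet S Q₁ → IsFacet S Q₂ →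
      ε Q₁ P * ε S Q₁ + ε Q₂ P * ε S Q₂ = 0

/-- The label of a cell induced by a labeling of the vertices: the componentwise maximum (the
exponent of the lcm) of the labels of the vertices of `X` in `P`. -/
def cellLabel (X : Set (Set (Fin n → ℝ))) (lab : (Fin n → ℝ) → (Fin n →₀ ℕ))
    (P : Set (Fin n → ℝ)) : Fin n →₀ ℕ :=
  Finsupp.equivFunOnFinite.symm
    (fun j => ⨆ v : {v : Fin n → ℝ // {v} ∈ X ∧ v ∈ P}, lab v.1 j)

/-- The cells that span homological degree `k`, i.e. those of dimension `k - 1`. -/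
def Cells (X : Set (Set (Fin n → ℝ))) (k : ℕ) : Type :=
  {P : Set (Fin n → ℝ) // P ∈ X ∧ cellDim P = (k : ℤ) - 1}

variable (K : Type*) [Field K]

/-- The free module of the cellular complex in homological degree `k`, with one basis element for
each cell of dimension `k - 1`. -/
abbrev CellularModule (X : Set (Set (Fin n → ℝ))) (k : ℕ) : Type _ :=
  Cells X k →₀ MvPolynomial (Fin n) K

open Classical in
/-- The differential `P ↦ ∑ ε(Q, P) x^(label P - label Q) Q`, the sum being over the facets `Q`
of `P`. -/
def cellularDifferential (X : Set (Set (Fin n → ℝ))) (lab : (Fin n → ℝ) → (Fin n →₀ ℕ))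
    (ε : Set (Fin n → ℝ) → Set (Fin n → ℝ) → ℤ) (k : ℕ) :
    CellularModule K X (k + 1) →ₗ[MvPolynomial (Fin n) K] CellularModule K X k :=
  Finsupp.linearCombination (MvPolynomial (Fin n) K) (fun P : Cells X (k + 1) =>
    ∑ᶠ Q : Cells X k,
      if IsFacet Q.1 P.1 then
        Finsupp.single Q
          (monomial (cellLabel X lab P.1 - cellLabel X lab Q.1) ((ε Q.1 P.1 : ℤ) : K))
      else 0)

/-- The augmentation `R = R^{F_{-1}(X)} → R / J`, which sends the basis element of the empty cell
to the class of `1`. -/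
def cellularAugmentation (X : Set (Set (Fin n → ℝ))) (J : Ideal (MvPolynomial (Fin n) K)) :
    CellularModule K X 0 →ₗ[MvPolynomial (Fin n) K] MvPolynomial (Fin n) K ⧸ J :=
  Finsupp.linearCombination (MvPolynomial (Fin n) K)
    (fun _ : Cells X 0 => Ideal.Quotient.mk J 1)

variable {K}

/-- `v` is homogeneous of multidegree `β`, where the basis element of a cell has its label as
multidegree. -/
def IsMultihomogeneous {X : Set (Set (Fin n → ℝ))} (lab : (Fin n → ℝ) → (Fin n →₀ ℕ)) {k : ℕ}
    (v : CellularModule K X k) (β : Fin n →₀ ℕ) : Prop :=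
  ∀ P : Cells X k, v P ≠ 0 →
    cellLabel X lab P.1 ≤ β ∧ ∃ c : K, v P = monomial (β - cellLabel X lab P.1) c

end Cellular

/-! ## The complex `X_I` -/

section TheComplex

variable {n : ℕ}

/-- `supp₁(m)`: the indices of the variables other than `x_1` that divide `m`. -/
def supp₁ (m : Fin n →₀ ℕ) : Finset (Fin n) :=
  m.support.filter (fun i => (i : ℕ) ≠ 0)

/-- The index `i - 1` (only used for indices of variables other than `x_1`). -/
def prev (i : Fin n) : Fin n :=
  ⟨(i : ℕ) - 1, lt_of_le_of_lt (Nat.sub_le _ _) i.isLt⟩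

/-- The monomial `m → σ`, that is `m ∏_{i ∈ σ} x_{i-1} / x_i` (used for `σ ⊆ supp₁(m)`). -/
def move (m : Fin n →₀ ℕ) (σ : Finset (Fin n)) : Fin n →₀ ℕ :=
  m + ∑ i ∈ σ, Finsupp.single (prev i) 1 - ∑ i ∈ σ, Finsupp.single i 1

/-- The lattice point of `ℝⁿ` of a monomial. -/
def toPoint (m : Fin n →₀ ℕ) : Fin n → ℝ := fun j => (m j : ℝ)

/-- `C(m, σ)`: the convex hull of the points `m → τ`, `τ ⊆ σ`. -/
def cell (m : Fin n →₀ ℕ) (σ : Finset (Fin n)) : Set (Fin n → ℝ) :=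
  convexHull ℝ ((fun τ : Finset (Fin n) => toPoint (move m τ)) '' {τ | τ ⊆ σ})

/-- `X_I`: the cells `C(m, σ)` with `m ∈ G(I)` and `σ ⊆ supp₁(m)`, together with the empty cell. -/
def cellComplex {K : Type*} [Field K] (I : Ideal (MvPolynomial (Fin n) K)) :
    Set (Set (Fin n → ℝ)) :=
  insert ∅ {P | ∃ m ∈ minGens I, ∃ σ ⊆ supp₁ m, P = cell m σ}

/-- The labeling of the vertices: the lattice point of the monomial `f` is labeled by (the exponent
of) `x^a / f`. Only the values at lattice points matter. -/
def dualLabel (a : Fin n →₀ ℕ) (v : Fin n → ℝ) : Fin n →₀ ℕ :=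
  Finsupp.equivFunOnFinite.symm (fun j => a j - ⌊v j⌋₊)

/-- `P = C(m, σ)` and `Q` is its facet `C(m, σ \ {j})`, where `j` is an element of `σ`. -/
def IsUpperFacetData (Q P : Set (Fin n → ℝ)) (m : Fin n →₀ ℕ) (σ : Finset (Fin n))
    (j : Fin n) : Prop :=
  σ ⊆ supp₁ m ∧ j ∈ σ ∧ P = cell m σ ∧ Q = cell m (σ.erase j)

/-- `P = C(m, σ)` and `Q` is its facet `C(m → {j}, σ \ {j})`, where `j` is an element of `σ`.
This is the facet parallel to `C(m, σ \ {j})`, its translate by `e_{j-1} - e_j`. -/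
def IsLowerFacetData (Q P : Set (Fin n → ℝ)) (m : Fin n →₀ ℕ) (σ : Finset (Fin n))
    (j : Fin n) : Prop :=
  σ ⊆ supp₁ m ∧ j ∈ σ ∧ P = cell m σ ∧ Q = cell (move m {j}) (σ.erase j)

/-- `(-1)^(t-1)` if `j` is the `t`-th smallest element of `σ`. -/
def koszulSign (σ : Finset (Fin n)) (j : Fin n) : ℤ :=
  (-1) ^ (σ.filter (fun i => i < j)).card

open Classical in
/-- The incidence function of `X_I`: `(-1)^(t-1)` on the facet `C(m, σ \ {j})` of `C(m, σ)` if `j`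
is the `t`-th smallest element of `σ`, the opposite sign on the parallel facet, and `1` on the
empty facet of a vertex. -/
def incidence (Q P : Set (Fin n → ℝ)) : ℤ :=
  if Q = ∅ ∧ cellDim P = 0 then 1
  else if h : ∃ p : (Fin n →₀ ℕ) × Finset (Fin n) × Fin n,
      IsUpperFacetData Q P p.1 p.2.1 p.2.2 then
    koszulSign h.choose.2.1 h.choose.2.2
  else if h : ∃ p : (Fin n →₀ ℕ) × Finset (Fin n) × Fin n,
      IsLowerFacetData Q P p.1 p.2.1 p.2.2 then
    -koszulSign h.choose.2.1 h.choose.2.2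
  else 0

end TheComplex

end CellularDual

end

open CellularDual

/-! In the linear coordinates `coordMap` the edge direction e_{i-1} - e_i becomes the i-th unit
vector, so C(m, σ) becomes a lattice cube with lower corner `tail m`, of side 1 in the directions of
σ and side 0 in the others (`mem_cell_iff`). Lattice cubes meet in common faces, a cube determines
its corner and its directions, and its faces arise by fixing some coordinates at an end. Strong
stability together with generation in one degree puts every m → τ into G(I), so these faces are
again cells of X_I. The signs are those of the cubical chain complex.

For exactness, cells are replaced by pairs (m, σ), with ∂(m, σ) = Σ ± (x_j (m, σ \ j) - x_{j-1} (m →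
j, σ \ j)), and acyclicity comes from a normal form instead of topology. Call a term x^u (m, σ)
reduced if the largest i ≥ 2 for which x_i divides both m and x^u x^σ lies in σ, or if there is no
such i. In a term that is not reduced this index μ lies outside σ and x_μ divides x^u; subtracting ±
the boundary of (x^u / x_μ) (m, σ ∪ μ) leaves reduced terms and one term at m → μ, of smaller
`energy`. Hence every chain is reduced modulo boundaries (`exists_sub_mem_reducedElements`).

Conversely, a nonzero reduced chain of positive dimension is not a cycle: a term of maximal energy
contributes x^u x_μ (m, σ \ μ) to the boundary, and no other term reaches it
(`eq_zero_of_pairDifferential_eq_zero`). In dimension 0, u and m have disjoint supports outside x_1,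
so x^u x^a / m determines m there, and the common degree gives the exponent of x_1
(`eq_zero_of_pairAugmentation_eq_zero`). So cycles are boundaries.

The coefficient of a nonempty facet is ± a variable, that of the empty facet of m is x^a / m; this
gives minimality unless the dual is the unit ideal. -/

namespace CellularDual

/-! ## Moves of monomials -/

section Moves

variable {n : ℕ}

lemma mem_supp₁ {m : Fin n →₀ ℕ} {i : Fin n} : i ∈ supp₁ m ↔ m i ≠ 0 ∧ (i : ℕ) ≠ 0 := by
  simp [supp₁]

lemma prev_lt {i : Fin n} (h : (i : ℕ) ≠ 0) : prev i < i := by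
  rw [Fin.lt_def, prev]
  simp only
  omega

lemma le_prev_iff {i k : Fin n} (h : (i : ℕ) ≠ 0) : k ≤ prev i ↔ k < i := by
  rw [Fin.lt_def, Fin.le_def, prev]
  simp only
  omega

lemma sum_single_apply (τ : Finset (Fin n)) (k : Fin n) :
    (∑ i ∈ τ, Finsupp.single i 1 : Fin n →₀ ℕ) k = if k ∈ τ then 1 else 0 := by
  rw [Finsupp.finsetSum_apply]
  simp [Finsupp.single_apply]

/-- The variables in τ divide m, so the truncated subtraction in `move` is exact. Later computations
use this additive form. -/
lemma move_add {m : Fin n →₀ ℕ} {τ : Finset (Fin n)} (h : τ ⊆ supp₁ m) :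
    move m τ + ∑ i ∈ τ, Finsupp.single i 1 = m + ∑ i ∈ τ, Finsupp.single (prev i) 1 := by
  rw [move, tsub_add_cancel_of_le]
  intro k
  rw [sum_single_apply, Finsupp.add_apply]
  split_ifs with hk
  · have := (mem_supp₁.1 (h hk)).1
    omega
  · exact Nat.zero_le _

lemma step_add {m : Fin n →₀ ℕ} {j : Fin n} (h : j ∈ supp₁ m) :
    move m {j} + Finsupp.single j 1 = m + Finsupp.single (prev j) 1 := by
  simpa using move_add (Finset.singleton_subset_iff.2 h)

@[simp] lemma move_empty (m : Fin n →₀ ℕ) : move m ∅ = m := by simp [move]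

lemma subset_supp₁_move {m : Fin n →₀ ℕ} {σ τ : Finset (Fin n)} (hσ : σ ⊆ supp₁ m)
    (hτ : τ ⊆ supp₁ m) (hd : Disjoint σ τ) : σ ⊆ supp₁ (move m τ) := by
  intro k hk
  have hk' := mem_supp₁.1 (hσ hk)
  refine mem_supp₁.2 ⟨?_, hk'.2⟩
  have h := DFunLike.congr_fun (move_add hτ) k
  rw [Finsupp.add_apply, Finsupp.add_apply, sum_single_apply,
    if_neg (Finset.disjoint_left.1 hd hk)] at h
  omega

lemma move_move {m : Fin n →₀ ℕ} {σ τ : Finset (Fin n)} (hσ : σ ⊆ supp₁ m)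
    (hτ : τ ⊆ supp₁ m) (hd : Disjoint σ τ) : move (move m τ) σ = move m (τ ∪ σ) := by
  have h1 := move_add (subset_supp₁_move hσ hτ hd)
  have h2 := move_add hτ
  have h3 := move_add (Finset.union_subset hτ hσ)
  rw [Finset.sum_union hd.symm, Finset.sum_union hd.symm] at h3
  apply add_right_cancel (b := ∑ i ∈ τ, Finsupp.single i 1 + ∑ i ∈ σ, Finsupp.single i 1)
  rw [h3, ← add_assoc m, ← h2, add_right_comm, ← h1]
  abel

lemma move_insert {m : Fin n →₀ ℕ} {τ : Finset (Fin n)} {j : Fin n} (h : insert j τ ⊆ supp₁ m)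
    (hj : j ∉ τ) : move m (insert j τ) = move (move m τ) {j} := by
  rw [move_move (Finset.singleton_subset_iff.2 (h (Finset.mem_insert_self _ _)))
    ((Finset.subset_insert _ _).trans h) (Finset.disjoint_singleton_left.2 hj)]
  congr 1
  ext; simp

lemma step_comm {m : Fin n →₀ ℕ} {j l : Fin n} (hj : j ∈ supp₁ m) (hl : l ∈ supp₁ m)
    (hjl : j ≠ l) : move (move m {j}) {l} = move (move m {l}) {j} := by
  rw [move_move, move_move, Finset.union_comm] <;> simp [*, hjl.symm]

lemma le_move_apply (m : Fin n →₀ ℕ) (τ : Finset (Fin n)) (k : Fin n) :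
    m k ≤ move m τ k + if k ∈ τ then 1 else 0 := by
  rw [move, Finsupp.tsub_apply, sum_single_apply, Finsupp.add_apply]
  omega

lemma move_singleton_apply_self {m : Fin n →₀ ℕ} {j : Fin n} (h : j ∈ supp₁ m) :
    move m {j} j + 1 = m j := by
  have h1 := DFunLike.congr_fun (step_add h) j
  have := (prev_lt (mem_supp₁.1 h).2).ne
  simpa [Finsupp.single_apply, this] using h1

lemma degree_move {m : Fin n →₀ ℕ} {τ : Finset (Fin n)} (h : τ ⊆ supp₁ m) :
    (move m τ).degree = m.degree := by
  have h1 := congrArg Finsupp.degree (move_add h)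
  simpa [map_sum] using h1

/-- The sum of the positions of the variables of `m`, which moves decrease. -/
noncomputable def energy : (Fin n →₀ ℕ) →+ ℕ :=
  Finsupp.weight (fun i : Fin n => (i : ℕ))

lemma energy_step {m : Fin n →₀ ℕ} {j : Fin n} (h : j ∈ supp₁ m) :
    energy (move m {j}) + 1 = energy m := by
  have h1 := congrArg energy (step_add h)
  have h2 := (mem_supp₁.1 h).2
  simp only [map_add, energy, Finsupp.weight_single, smul_eq_mul, one_mul, prev] at h1 ⊢
  omega

end Moves

/-! ## Minimal generators of strongly stable ideals -/

section Generators

variable {K : Type*} [Field K] {n d : ℕ} {I : Ideal (MvPolynomial (Fin n) K)}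

/-- Some minimal generator divides the monomial and has the same degree d, hence equals it. This
turns membership in I into membership in G(I). -/
lemma mem_minGens_of_degree (hdeg : GeneratedInDegree I d) {m : Fin n →₀ ℕ}
    (hm : monomial m (1 : K) ∈ I) (hd : m.degree = d) : m ∈ minGens I := by
  refine ⟨hm, fun m' hm' hle => ?_⟩
  obtain ⟨g, hgm, hg⟩ := exists_minimal_le_of_wellFoundedLT
    (fun m' : Fin n →₀ ℕ => monomial m' (1 : K) ∈ I) m' hm'
  obtain ⟨c, rfl⟩ := exists_add_of_le (hgm.trans hle)
  have h1 := hdeg g hg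
  rw [map_add, h1] at hd
  have hc : c = 0 := (Finsupp.degree_eq_zero_iff c).1 (by omega)
  simpa [hc] using hgm

lemma step_mem_minGens (hstable : IsStronglyStable I) (hdeg : GeneratedInDegree I d)
    {m : Fin n →₀ ℕ} (hm : m ∈ minGens I) {j : Fin n} (hj : j ∈ supp₁ m) :
    move m {j} ∈ minGens I := by
  apply mem_minGens_of_degree hdeg
  · have := hstable m hm.1 j (Finset.filter_subset _ _ hj) (prev j) (prev_lt (mem_supp₁.1 hj).2)
    simpa [move] using this
  · rw [degree_move (Finset.singleton_subset_iff.2 hj)]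
    exact hdeg m hm

lemma move_mem_of_step_mem {G : Set (Fin n →₀ ℕ)}
    (hG : ∀ m ∈ G, ∀ j ∈ supp₁ m, move m {j} ∈ G) {m : Fin n →₀ ℕ} (hm : m ∈ G)
    {τ : Finset (Fin n)} (hτ : τ ⊆ supp₁ m) : move m τ ∈ G := by
  induction τ using Finset.induction_on with
  | empty => simpa using hm
  | insert j τ hj ih =>
    have hτ' := (Finset.subset_insert j τ).trans hτ
    rw [move_insert hτ hj]
    refine hG _ (ih hτ') _ ?_
    exact Finset.singleton_subset_iff.1 (subset_supp₁_move
      (Finset.singleton_subset_iff.2 (hτ (Finset.mem_insert_self _ _))) hτ'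
      (Finset.disjoint_singleton_left.2 hj))

lemma move_mem_minGens (hstable : IsStronglyStable I) (hdeg : GeneratedInDegree I d)
    {m : Fin n →₀ ℕ} (hm : m ∈ minGens I) {τ : Finset (Fin n)} (hτ : τ ⊆ supp₁ m) :
    move m τ ∈ minGens I :=
  move_mem_of_step_mem (fun _ h _ hj => step_mem_minGens hstable hdeg h hj) hm hτ

lemma finite_minGens {a : Fin n →₀ ℕ} (hdet : IsDetermined I a) : (minGens I).Finite :=
  (Set.finite_Iic a).subset hdet

end Generators

/-! ## Signs -/

section Koszul

variable {n : ℕ}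

lemma koszulSign_mul_self (σ : Finset (Fin n)) (j : Fin n) :
    koszulSign σ j * koszulSign σ j = 1 := by
  rw [koszulSign, ← pow_add, Even.neg_one_pow ⟨_, rfl⟩]

lemma koszulSign_eq_one_or (σ : Finset (Fin n)) (j : Fin n) :
    koszulSign σ j = 1 ∨ koszulSign σ j = -1 :=
  neg_one_pow_eq_or ℤ _

lemma koszulSign_erase_of_lt {σ : Finset (Fin n)} {j l : Fin n} (h : j < l) :
    koszulSign (σ.erase l) j = koszulSign σ j := by
  rw [koszulSign, koszulSign, Finset.filter_erase, Finset.erase_eq_of_notMem]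
  simp [h.le]

lemma koszulSign_erase_of_gt {σ : Finset (Fin n)} {j l : Fin n} (h : j < l) (hj : j ∈ σ) :
    koszulSign (σ.erase j) l = -koszulSign σ l := by
  rw [koszulSign, koszulSign, Finset.filter_erase,
    ← Finset.card_erase_add_one (s := σ.filter (fun i => i < l)) (a := j) (by simp [h, hj]),
    pow_succ]
  ring

/-- Removing the smaller of two indices shifts the position of the larger by one; removing the
larger leaves the smaller in place. -/
lemma koszulSign_antisymm {σ : Finset (Fin n)} {j l : Fin n} (hj : j ∈ σ) (hl : l ∈ σ)
    (hjl : j ≠ l) : koszulSign σ j * koszulSign (σ.erase j) l =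
      -(koszulSign σ l * koszulSign (σ.erase l) j) := by
  rcases lt_or_gt_of_ne hjl with h | h
  · rw [koszulSign_erase_of_lt h, koszulSign_erase_of_gt h hj]
    ring
  · rw [koszulSign_erase_of_lt h, koszulSign_erase_of_gt h hl]
    ring

end Koszul

/-! ## Geometry of the cells -/

section Geometry

variable {n : ℕ}

variable (n) in
/-- The linear coordinates `x ↦ (-(x_i + ⋯ + x_n))_i`, in which the cells are unit cubes. -/
noncomputable def coordMap : (Fin n → ℝ) →ₗ[ℝ] (Fin n → ℝ) :=
  LinearMap.pi fun i => -∑ j ∈ Finset.Ici i, LinearMap.proj j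

/-- The coordinates of a lattice point. -/
def tail (m : Fin n →₀ ℕ) (i : Fin n) : ℤ := -∑ j ∈ Finset.Ici i, (m j : ℤ)

/-- The direction `e_{i-1} - e_i` of an edge. -/
noncomputable def direction (i : Fin n) : Fin n → ℝ := Pi.single (prev i) 1 - Pi.single i 1

lemma coordMap_apply (x : Fin n → ℝ) (i : Fin n) :
    coordMap n x i = -∑ j ∈ Finset.Ici i, x j := by
  simp [coordMap]

lemma coordMap_toPoint (m : Fin n →₀ ℕ) (i : Fin n) : coordMap n (toPoint m) i = tail m i := by
  simp [coordMap_apply, tail, toPoint]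

lemma coordMap_direction {i : Fin n} (hi : (i : ℕ) ≠ 0) :
    coordMap n (direction i) = Pi.single i 1 := by
  ext k
  rw [coordMap_apply]
  simp only [direction, Pi.sub_apply, Finset.sum_sub_distrib, Pi.single_apply,
    Finset.sum_ite_eq', Finset.mem_Ici, le_prev_iff hi]
  rcases lt_trichotomy k i with h | h | h
  · simp [h, h.le, h.ne]
  · simp [h]
  · simp [h.not_gt, h.not_ge, h.ne']

lemma coordMap_injective : Function.Injective (coordMap n) := by
  rw [injective_iff_map_eq_zero]
  intro x hx
  ext i
  induction i using WellFoundedGT.induction with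
  | _ i ih =>
  have h := congrFun hx i
  rw [coordMap_apply, Finset.sum_eq_single_of_mem i (Finset.mem_Ici.2 le_rfl)
    fun j hj hji => ih j (lt_of_le_of_ne (Finset.mem_Ici.1 hj) (Ne.symm hji))] at h
  simpa using h

lemma toPoint_injective : Function.Injective (toPoint (n := n)) := by
  intro m m' h
  ext i
  have := congrFun h i
  simpa [toPoint] using this

lemma eq_of_tail_eq {m m' : Fin n →₀ ℕ} (h : ∀ i, tail m i = tail m' i) : m = m' := by
  apply toPoint_injective
  apply coordMap_injective
  ext i
  rw [coordMap_toPoint, coordMap_toPoint, h]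

lemma toPoint_move {m : Fin n →₀ ℕ} {τ : Finset (Fin n)} (hτ : τ ⊆ supp₁ m) :
    toPoint (move m τ) = toPoint m + ∑ i ∈ τ, direction i := by
  ext k
  have h := congrArg (Nat.cast : ℕ → ℝ) (DFunLike.congr_fun (move_add hτ) k)
  rw [Finsupp.add_apply, Finsupp.add_apply, Finsupp.finsetSum_apply, Finsupp.finsetSum_apply] at h
  push_cast at h
  simp only [toPoint, direction, Pi.add_apply, Finset.sum_apply, Pi.sub_apply,
    Finset.sum_sub_distrib]
  rw [← add_sub_assoc, eq_sub_iff_add_eq]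
  convert h using 3 with i _ i _
  · simp [Pi.single_apply, Finsupp.single_apply, eq_comm]
  · simp [Pi.single_apply, Finsupp.single_apply, eq_comm]

lemma coordMap_sum_direction {τ : Finset (Fin n)} (hτ : ∀ i ∈ τ, (i : ℕ) ≠ 0)
    (c : Fin n → ℝ) (i : Fin n) :
    coordMap n (∑ j ∈ τ, c j • direction j) i = if i ∈ τ then c i else 0 := by
  rw [map_sum, Finset.sum_apply, Finset.sum_congr rfl (g := fun j => if i = j then c j else 0)]
  · simp
  · intro j hj
    simp [coordMap_direction (hτ j hj), Pi.single_apply]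

lemma tail_move {m : Fin n →₀ ℕ} {τ : Finset (Fin n)} (hτ : τ ⊆ supp₁ m) (i : Fin n) :
    tail (move m τ) i = tail m i + if i ∈ τ then 1 else 0 := by
  have h := congrFun (congrArg (coordMap n) (toPoint_move hτ)) i
  have h1 := coordMap_sum_direction (fun i hi => (mem_supp₁.1 (hτ hi)).2) (fun _ => 1) i
  simp only [one_smul] at h1
  rw [map_add, Pi.add_apply, h1, coordMap_toPoint, coordMap_toPoint] at h
  split_ifs at h ⊢ <;> exact_mod_cast h

/-- The points m → τ have as image the product of the sets {t_i, t_i + [i ∈ σ]} with t = `tail m`,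
and convex hulls commute with linear images and with products. -/
lemma mem_cell_iff {m : Fin n →₀ ℕ} {σ : Finset (Fin n)} (hσ : σ ⊆ supp₁ m) {x : Fin n → ℝ} :
    x ∈ cell m σ ↔ ∀ i, (tail m i : ℝ) ≤ coordMap n x i ∧
      coordMap n x i ≤ tail m i + if i ∈ σ then 1 else 0 := by
  have himage : coordMap n '' cell m σ =
      Set.univ.pi fun i => Set.Icc (tail m i : ℝ) (tail m i + if i ∈ σ then 1 else 0) := by
    have h1 : coordMap n '' ((fun τ : Finset (Fin n) => toPoint (move m τ)) '' {τ | τ ⊆ σ}) =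
        Set.univ.pi fun i =>
          ({(tail m i : ℝ), (tail m i : ℝ) + if i ∈ σ then 1 else 0} : Set ℝ) := by
      ext y
      simp only [Set.mem_image, Set.mem_ofPred_eq, exists_exists_and_eq_and, Set.mem_pi,
        Set.mem_univ, true_implies, Set.mem_insert_iff, Set.mem_singleton_iff]
      constructor
      · rintro ⟨τ, hτ, rfl⟩ i
        rw [coordMap_toPoint, tail_move (hτ.trans hσ)]
        by_cases h : i ∈ τ
        · simp [h, hτ h]
        · simp [h]
      · intro hy
        -- A corner y is m → τ for the set τ of directions in which y sits at the upper end.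
        refine ⟨σ.filter (fun i => y i = tail m i + 1), Finset.filter_subset _ _, ?_⟩
        ext i
        rw [coordMap_toPoint, tail_move ((Finset.filter_subset _ _).trans hσ)]
        have := hy i
        by_cases h : i ∈ σ
        · by_cases h' : y i = tail m i + 1
          · simp [h, h']
          · simp only [h, h', if_true, or_false] at this
            simp [this]
        · simp only [h, if_false, add_zero, or_self] at this
          simp [h, this]
    rw [cell, LinearMap.image_convexHull, h1, convexHull_pi]
    congr 1
    ext1 i
    rw [convexHull_pair, segment_eq_Icc]
    split_ifs <;> simp
  rw [← coordMap_injective.mem_set_image, himage]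
  simp only [Set.mem_pi, Set.mem_univ, true_implies, Set.mem_Icc]

lemma toPoint_mem_cell_iff {m m' : Fin n →₀ ℕ} {σ : Finset (Fin n)} (hσ : σ ⊆ supp₁ m) :
    toPoint m' ∈ cell m σ ↔ ∀ i, tail m i ≤ tail m' i ∧
      tail m' i ≤ tail m i + if i ∈ σ then 1 else 0 := by
  rw [mem_cell_iff hσ]
  refine forall_congr' fun i => ?_
  rw [coordMap_toPoint]
  split_ifs <;> norm_cast

lemma toPoint_move_mem_cell {m : Fin n →₀ ℕ} {σ τ : Finset (Fin n)} (hτ : τ ⊆ σ) :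
    toPoint (move m τ) ∈ cell m σ :=
  subset_convexHull ℝ _ ⟨τ, hτ, rfl⟩

lemma toPoint_mem_cell (m : Fin n →₀ ℕ) (σ : Finset (Fin n)) : toPoint m ∈ cell m σ := by
  simpa using toPoint_move_mem_cell (m := m) (Finset.empty_subset σ)

lemma cell_nonempty (m : Fin n →₀ ℕ) (σ : Finset (Fin n)) : (cell m σ).Nonempty :=
  ⟨_, toPoint_mem_cell m σ⟩

lemma cell_empty (m : Fin n →₀ ℕ) : cell m ∅ = {toPoint m} := by
  simp [cell, Finset.subset_empty]

lemma cell_subset_cell_iff {m m' : Fin n →₀ ℕ} {σ σ' : Finset (Fin n)} (hσ : σ ⊆ supp₁ m)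
    (hσ' : σ' ⊆ supp₁ m') : cell m' σ' ⊆ cell m σ ↔ ∀ i, tail m i ≤ tail m' i ∧
      (tail m' i + if i ∈ σ' then 1 else 0) ≤ tail m i + if i ∈ σ then 1 else 0 := by
  constructor
  · intro h i
    have h1 := (toPoint_mem_cell_iff hσ).1 (h (toPoint_mem_cell m' σ')) i
    have h2 := (toPoint_mem_cell_iff hσ).1 (h (toPoint_move_mem_cell Finset.Subset.rfl)) i
    rw [tail_move hσ'] at h2
    exact ⟨h1.1, h2.2⟩
  · intro h x hx
    rw [mem_cell_iff hσ'] at hx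
    rw [mem_cell_iff hσ]
    intro i
    have h1 : (tail m i : ℝ) ≤ tail m' i := by exact_mod_cast (h i).1
    have h2 : (tail m' i + if i ∈ σ' then 1 else 0 : ℝ) ≤ tail m i + if i ∈ σ then 1 else 0 := by
      exact_mod_cast (h i).2
    exact ⟨h1.trans (hx i).1, (hx i).2.trans h2⟩

lemma cell_injective {m m' : Fin n →₀ ℕ} {σ σ' : Finset (Fin n)} (hσ : σ ⊆ supp₁ m)
    (hσ' : σ' ⊆ supp₁ m') (h : cell m σ = cell m' σ') : m = m' ∧ σ = σ' := by
  have h1 := (cell_subset_cell_iff hσ hσ').1 h.ge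
  have h2 := (cell_subset_cell_iff hσ' hσ).1 h.le
  refine ⟨eq_of_tail_eq fun i => le_antisymm (h1 i).1 (h2 i).1, ?_⟩
  ext i
  have h3 := h1 i
  have h4 := h2 i
  by_cases hi : i ∈ σ <;> by_cases hi' : i ∈ σ' <;> simp only [hi, hi', if_true, if_false] at * <;>
    omega

/-- A direction of the large cube that is missing in the small one is fixed at an end; ρ collects
those fixed at the upper end. -/
lemma exists_move_of_cell_subset {m m' : Fin n →₀ ℕ} {σ σ' : Finset (Fin n)} (hσ : σ ⊆ supp₁ m)
    (hσ' : σ' ⊆ supp₁ m') (h : cell m' σ' ⊆ cell m σ) :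
    σ' ⊆ σ ∧ ∃ ρ ⊆ σ, Disjoint ρ σ' ∧ m' = move m ρ := by
  rw [cell_subset_cell_iff hσ hσ'] at h
  have hsub : σ' ⊆ σ := by
    intro i hi
    by_contra hi'
    have := h i
    simp only [hi, hi', if_true, if_false] at this
    omega
  have hρ : σ.filter (fun i => tail m' i = tail m i + 1) ⊆ σ := Finset.filter_subset _ _
  refine ⟨hsub, _, hρ, ?_, eq_of_tail_eq fun i => ?_⟩
  · rw [Finset.disjoint_left]
    intro i hi hi'
    rw [Finset.mem_filter] at hi
    have := h i
    simp only [hi, hi', if_true] at this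
    omega
  · rw [tail_move (hρ.trans hσ)]
    have := h i
    simp only [Finset.mem_filter]
    split_ifs at this ⊢ <;> grind

lemma direction_linearIndependent {σ : Finset (Fin n)} (hσ : ∀ i ∈ σ, (i : ℕ) ≠ 0) :
    LinearIndependent ℝ (fun i : σ => direction (i : Fin n)) := by
  refine LinearIndependent.of_comp (coordMap n) ?_
  have h : (coordMap n ∘ fun i : σ => direction (i : Fin n)) =
      (fun i : Fin n => (Pi.single i 1 : Fin n → ℝ)) ∘ (Subtype.val : σ → Fin n) := by
    ext1 i
    exact coordMap_direction (hσ i i.2)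
  rw [h]
  exact (Pi.linearIndependent_single_one (Fin n) ℝ).comp _ Subtype.val_injective

lemma vectorSpan_cell {m : Fin n →₀ ℕ} {σ : Finset (Fin n)} (hσ : σ ⊆ supp₁ m) :
    vectorSpan ℝ (cell m σ) =
      Submodule.span ℝ (Set.range fun i : σ => direction (i : Fin n)) := by
  have h : toPoint m ∈ (fun τ : Finset (Fin n) => toPoint (move m τ)) '' {τ | τ ⊆ σ} :=
    ⟨∅, Finset.empty_subset σ, by simp⟩
  rw [cell, ← direction_affineSpan, affineSpan_convexHull, direction_affineSpan,
    vectorSpan_eq_span_vsub_set_right ℝ h]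
  apply le_antisymm
  · rw [Submodule.span_le]
    rintro _ ⟨_, ⟨τ, hτ, rfl⟩, rfl⟩
    have hτ' : τ ⊆ σ := hτ
    simp only [toPoint_move (hτ'.trans hσ), vsub_eq_sub, add_sub_cancel_left]
    exact Submodule.sum_mem _ fun i hi => Submodule.subset_span ⟨⟨i, hτ' hi⟩, rfl⟩
  · rw [Submodule.span_le]
    rintro _ ⟨⟨i, hi⟩, rfl⟩
    refine Submodule.subset_span ⟨_, ⟨{i}, Finset.singleton_subset_iff.2 hi, rfl⟩, ?_⟩
    simp [toPoint_move (Finset.singleton_subset_iff.2 (hσ hi))]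

lemma cellDim_cell {m : Fin n →₀ ℕ} {σ : Finset (Fin n)} (hσ : σ ⊆ supp₁ m) :
    cellDim (cell m σ) = σ.card := by
  rw [cellDim, if_neg (cell_nonempty m σ).ne_empty, vectorSpan_cell hσ,
    finrank_span_eq_card (direction_linearIndependent fun i hi => (mem_supp₁.1 (hσ hi)).2),
    Fintype.card_coe]

lemma cellDim_empty : cellDim (∅ : Set (Fin n → ℝ)) = -1 := by simp [cellDim]

/-! ### Faces -/

lemma eq_add_sum_direction {m : Fin n →₀ ℕ} {σ : Finset (Fin n)} (hσ : σ ⊆ supp₁ m)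
    {x : Fin n → ℝ} (hx : x ∈ cell m σ) :
    x = toPoint m + ∑ i ∈ σ, (coordMap n x i - tail m i) • direction i := by
  apply coordMap_injective
  ext i
  rw [map_add, Pi.add_apply, coordMap_sum_direction fun i hi => (mem_supp₁.1 (hσ hi)).2,
    coordMap_toPoint]
  have h := (mem_cell_iff hσ).1 hx i
  split_ifs at h ⊢
  · ring
  · linarith [h.1, h.2]

/-- In cube coordinates a linear functional is maximized one coordinate at a time: a positive slope
forces the upper end, a negative slope the lower end, and slope zero leaves the coordinate free. -/
lemma exposed_eq_cell {m : Fin n →₀ ℕ} {σ : Finset (Fin n)} (hσ : σ ⊆ supp₁ m)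
    (l : StrongDual ℝ (Fin n → ℝ)) :
    {x ∈ cell m σ | ∀ y ∈ cell m σ, l y ≤ l x} =
      cell (move m (σ.filter fun i => 0 < l (direction i)))
        (σ.filter fun i => l (direction i) = 0) := by
  set ρ := σ.filter fun i => 0 < l (direction i) with hρ
  set τ := σ.filter fun i => l (direction i) = 0 with hτ
  have hρσ : ρ ⊆ σ := Finset.filter_subset _ _
  have hτσ : τ ⊆ σ := Finset.filter_subset _ _
  have hdisj : Disjoint τ ρ := Finset.disjoint_filter.2 fun i _ h h' => h'.ne' h
  have hτ' := subset_supp₁_move (hτσ.trans hσ) (hρσ.trans hσ) hdisj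
  have hl : ∀ x ∈ cell m σ, l x = l (toPoint m) +
      ∑ i ∈ σ, (coordMap n x i - tail m i) * l (direction i) := by
    intro x hx
    conv_lhs => rw [eq_add_sum_direction hσ hx]
    simp [map_sum]
  have hb : toPoint (move m ρ) ∈ cell m σ := toPoint_move_mem_cell hρσ
  have hterm : ∀ x ∈ cell m σ, ∀ i ∈ σ, (coordMap n x i - tail m i) * l (direction i) ≤
      (coordMap n (toPoint (move m ρ)) i - tail m i) * l (direction i) := by
    intro x hx i hi
    have h := (mem_cell_iff hσ).1 hx i
    rw [if_pos hi] at h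
    rw [coordMap_toPoint, tail_move (hρσ.trans hσ)]
    by_cases hpos : 0 < l (direction i)
    · rw [if_pos (Finset.mem_filter.2 ⟨hi, hpos⟩)]
      push_cast
      nlinarith [h.1, h.2]
    · rw [if_neg (fun h : i ∈ ρ => hpos (Finset.mem_filter.1 h).2)]
      push_cast
      nlinarith [h.1, h.2]
  have hmax : ∀ x ∈ cell m σ, l x ≤ l (toPoint (move m ρ)) := by
    intro x hx
    rw [hl x hx, hl _ hb]
    gcongr 1
    exact Finset.sum_le_sum (hterm x hx)
  ext x
  rw [Set.mem_ofPred_eq, mem_cell_iff hτ']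
  constructor
  · rintro ⟨hx, hxmax⟩ i
    have heq : l x = l (toPoint (move m ρ)) := le_antisymm (hmax x hx) (hxmax _ hb)
    rw [hl x hx, hl _ hb, add_right_inj, Finset.sum_eq_sum_iff_of_le (hterm x hx)] at heq
    have h := (mem_cell_iff hσ).1 hx i
    rw [tail_move (hρσ.trans hσ)]
    by_cases hi : i ∈ σ
    · have h1 := heq i hi
      rw [if_pos hi] at h
      rw [coordMap_toPoint, tail_move (hρσ.trans hσ)] at h1
      by_cases hz : l (direction i) = 0
      · rw [if_neg (fun h => (Finset.mem_filter.1 h).2.ne' hz),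
          if_pos (Finset.mem_filter.2 ⟨hi, hz⟩)]
        simpa using h
      · have h2 := mul_right_cancel₀ hz h1
        rw [sub_left_inj] at h2
        rw [h2, if_neg (fun h : i ∈ τ => hz (Finset.mem_filter.1 h).2)]
        simp
    · rw [if_neg hi] at h
      rw [if_neg (fun h => hi (hρσ h)), if_neg (fun h => hi (hτσ h))]
      simpa using h
  · intro hx
    have hxσ : x ∈ cell m σ := by
      refine (cell_subset_cell_iff hσ hτ').2 (fun i => ?_) ((mem_cell_iff hτ').2 hx)
      rw [tail_move (hρσ.trans hσ)]
      by_cases h1 : i ∈ ρ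
      · simp [h1, hρσ h1, Finset.disjoint_right.1 hdisj h1]
      · by_cases h2 : i ∈ τ
        · simp [h1, h2, hτσ h2]
        · simp only [h1, h2, if_false]
          split_ifs <;> simp
    refine ⟨hxσ, fun y hy => (hmax y hy).trans ?_⟩
    rw [hl x hxσ, hl _ hb, add_le_add_iff_left]
    refine Finset.sum_le_sum fun i hi => le_of_eq ?_
    by_cases hz : l (direction i) = 0
    · rw [hz, mul_zero, mul_zero]
    · have h := hx i
      rw [if_neg (fun h : i ∈ τ => hz (Finset.mem_filter.1 h).2), add_zero] at h
      rw [coordMap_toPoint, le_antisymm h.2 h.1]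

/-- In each coordinate, two meeting intervals with integer ends and length at most 1 intersect in an
end of the first or in all of it. This needs no condition on the set of generators. -/
lemma isExposed_inter {m m' : Fin n →₀ ℕ} {σ σ' : Finset (Fin n)} (hσ : σ ⊆ supp₁ m)
    (hσ' : σ' ⊆ supp₁ m') : IsExposed ℝ (cell m σ) (cell m σ ∩ cell m' σ') := by
  rintro ⟨x₀, hx₀, hx₀'⟩
  set B : Fin n → ℤ := fun i => tail m i + if i ∈ σ then 1 else 0 with hB
  set B' : Fin n → ℤ := fun i => tail m' i + if i ∈ σ' then 1 else 0 with hB'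
  have hBb : ∀ i, B i ≤ tail m i + 1 := fun i => by
    simp only [hB]; split_ifs <;> omega
  have hBb' : ∀ i, B' i ≤ tail m' i + 1 := fun i => by
    simp only [hB']; split_ifs <;> omega
  have hmem : ∀ x, x ∈ cell m σ ↔
      ∀ i, (tail m i : ℝ) ≤ coordMap n x i ∧ coordMap n x i ≤ B i := by
    intro x
    rw [mem_cell_iff hσ]
    refine forall_congr' fun i => ?_
    simp only [hB]
    split_ifs <;> simp
  have hmem' : ∀ x, x ∈ cell m' σ' ↔
      ∀ i, (tail m' i : ℝ) ≤ coordMap n x i ∧ coordMap n x i ≤ B' i := by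
    intro x
    rw [mem_cell_iff hσ']
    refine forall_congr' fun i => ?_
    simp only [hB']
    split_ifs <;> simp
  -- If the second interval starts later, only the upper end of the first is common; if it stops
  -- earlier, only the lower end; otherwise it contains the first. The weights 1, -1 and 0 expose
  -- exactly these sets.
  set c : Fin n → ℝ := fun i => if tail m i < tail m' i then 1 else if B' i < B i then -1 else 0
    with hc
  have hx₀P := (hmem x₀).1 hx₀
  have hx₀Q := (hmem' x₀).1 hx₀'
  have hterm : ∀ x ∈ cell m σ, ∀ i ∈ Finset.univ,
      c i * coordMap n x i ≤ c i * coordMap n x₀ i := by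
    intro x hx i _
    have hxi := (hmem x).1 hx i
    simp only [hc]
    split_ifs with h1 h2
    · have h3 : (B i : ℝ) ≤ tail m' i := by exact_mod_cast (hBb i).trans h1
      linarith [(hx₀Q i).1, hxi.2]
    · have h3 : (B' i : ℝ) ≤ tail m i := by
        have := hBb i
        exact_mod_cast (by omega : B' i ≤ tail m i)
      linarith [(hx₀Q i).2, hxi.1]
    · simp
  set l : StrongDual ℝ (Fin n → ℝ) :=
    LinearMap.toContinuousLinearMap (∑ i, c i • (LinearMap.proj i ∘ₗ coordMap n)) with hl
  have hlx : ∀ x, l x = ∑ i, c i * coordMap n x i := by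
    intro x
    simp [hl]
  refine ⟨l, ?_⟩
  have hmax : ∀ y ∈ cell m σ, l y ≤ l x₀ := fun y hy => by
    rw [hlx, hlx]
    exact Finset.sum_le_sum (hterm y hy)
  ext x
  rw [Set.mem_ofPred_eq, Set.mem_inter_iff]
  refine and_congr_right fun hx => ⟨fun hx' y hy => (hmax y hy).trans ?_, fun h => ?_⟩
  · rw [hlx, hlx]
    refine Finset.sum_le_sum fun i _ => ?_
    have hxi := (hmem' x).1 hx' i
    simp only [hc]
    split_ifs with h1 h2
    · have h3 : (B i : ℝ) ≤ tail m' i := by exact_mod_cast (hBb i).trans h1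
      linarith [(hx₀P i).2]
    · have h3 : (B' i : ℝ) ≤ tail m i := by
        have := hBb i
        exact_mod_cast (by omega : B' i ≤ tail m i)
      linarith [(hx₀P i).1]
    · simp
  · have heq : l x = l x₀ := le_antisymm (hmax x hx) (h x₀ hx₀)
    rw [hlx, hlx, Finset.sum_eq_sum_iff_of_le (hterm x hx)] at heq
    refine (hmem' x).2 fun i => ?_
    have h1 := heq i (Finset.mem_univ i)
    have hxi := (hmem x).1 hx i
    simp only [hc] at h1
    split_ifs at h1 with h2 h3
    · rw [one_mul, one_mul] at h1
      rw [h1]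
      exact hx₀Q i
    · rw [neg_one_mul, neg_one_mul, neg_inj] at h1
      rw [h1]
      exact hx₀Q i
    · have h4 : (tail m' i : ℝ) ≤ tail m i := by exact_mod_cast not_lt.1 h2
      have h5 : (B i : ℝ) ≤ B' i := by exact_mod_cast not_lt.1 h3
      exact ⟨h4.trans hxi.1, hxi.2.trans h5⟩

end Geometry

/-! ### The complex -/

section Complex

variable {K : Type*} [Field K] {n d : ℕ} {I : Ideal (MvPolynomial (Fin n) K)} {a : Fin n →₀ ℕ}

lemma cell_mem_cellComplex {m : Fin n →₀ ℕ} (hm : m ∈ minGens I) {σ : Finset (Fin n)}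
    (hσ : σ ⊆ supp₁ m) : cell m σ ∈ cellComplex I :=
  Set.mem_insert_of_mem _ ⟨m, hm, σ, hσ, rfl⟩

lemma empty_mem_cellComplex : ∅ ∈ cellComplex I := Set.mem_insert _ _

lemma finite_cellComplex (hdet : IsDetermined I a) : (cellComplex I).Finite := by
  refine Set.Finite.insert _ (((finite_minGens hdet).prod Set.finite_univ).image
    (fun p : (Fin n →₀ ℕ) × Finset (Fin n) => cell p.1 p.2) |>.subset ?_)
  rintro _ ⟨m, hm, σ, -, rfl⟩
  exact ⟨(m, σ), ⟨hm, Set.mem_univ _⟩, rfl⟩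

lemma isPolyhedralComplex_cellComplex (hstable : IsStronglyStable I)
    (hdeg : GeneratedInDegree I d) (hdet : IsDetermined I a) :
    IsPolyhedralComplex (cellComplex I) where
  finite := finite_cellComplex hdet
  empty_mem := empty_mem_cellComplex
  polytope := by
    classical
    rintro P (rfl | ⟨m, -, σ, -, rfl⟩)
    · exact ⟨∅, by simp⟩
    · refine ⟨σ.powerset.image fun τ => toPoint (move m τ), ?_⟩
      rw [cell]
      congr 1
      ext x
      simp
  face_mem := by
    intro P hP F hF
    rcases F.eq_empty_or_nonempty with rfl | hne
    · exact empty_mem_cellComplex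
    obtain ⟨l, rfl⟩ := hF hne
    rcases hP with rfl | ⟨m, hm, σ, hσ, rfl⟩
    · obtain ⟨x, hx⟩ := hne
      exact absurd hx.1 (Set.notMem_empty x)
    · rw [exposed_eq_cell hσ l]
      have h1 : (σ.filter fun i => 0 < l (direction i)) ⊆ supp₁ m :=
        (Finset.filter_subset _ _).trans hσ
      refine cell_mem_cellComplex (move_mem_minGens hstable hdeg hm h1)
        (subset_supp₁_move ((Finset.filter_subset _ _).trans hσ) h1
          (Finset.disjoint_filter.2 fun i _ h h' => h'.ne' h))
  inter_face := by
    have h : ∀ P ∈ cellComplex I, ∀ Q ∈ cellComplex I, IsExposed ℝ P (P ∩ Q) := by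
      rintro P (rfl | ⟨m, -, σ, hσ, rfl⟩) Q (rfl | ⟨m', -, σ', hσ', rfl⟩)
      · simpa using isExposed_empty
      · simpa using isExposed_empty
      · simpa using isExposed_empty
      · exact isExposed_inter hσ hσ'
    exact fun P hP Q hQ => ⟨h P hP Q hQ, Set.inter_comm P Q ▸ h Q hQ P hP⟩

/-! ### Labels -/

lemma dualLabel_toPoint (a m : Fin n →₀ ℕ) : dualLabel a (toPoint m) = a - m := by
  ext j
  simp [dualLabel, toPoint]

lemma bddAbove_dualLabel (a : Fin n →₀ ℕ) {ι : Type*} (f : ι → Fin n → ℝ) (j : Fin n) :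
    BddAbove (Set.range fun v => dualLabel a (f v) j) := by
  refine ⟨a j, ?_⟩
  rintro _ ⟨v, rfl⟩
  exact Nat.sub_le _ _

lemma cellLabel_empty (X : Set (Set (Fin n → ℝ))) (lab : (Fin n → ℝ) → (Fin n →₀ ℕ)) :
    cellLabel X lab ∅ = 0 := by
  ext j
  have : IsEmpty {v : Fin n → ℝ // {v} ∈ X ∧ v ∈ (∅ : Set (Fin n → ℝ))} := ⟨fun v => v.2.2⟩
  simp [cellLabel]

lemma cellLabel_mono (X : Set (Set (Fin n → ℝ))) (a : Fin n →₀ ℕ) {P Q : Set (Fin n → ℝ)}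
    (h : Q ⊆ P) : cellLabel X (dualLabel a) Q ≤ cellLabel X (dualLabel a) P := by
  intro j
  change (⨆ v : {v : Fin n → ℝ // {v} ∈ X ∧ v ∈ Q}, dualLabel a v.1 j) ≤
    ⨆ v : {v : Fin n → ℝ // {v} ∈ X ∧ v ∈ P}, dualLabel a v.1 j
  refine ciSup_le' fun v => ?_
  exact le_ciSup (bddAbove_dualLabel a (fun v : {v : Fin n → ℝ // {v} ∈ X ∧ v ∈ P} => v.1) j)
    ⟨v.1, v.2.1, h v.2.2⟩

lemma exists_toPoint_of_singleton_mem {v : Fin n → ℝ} (h : {v} ∈ cellComplex I) :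
    ∃ m ∈ minGens I, v = toPoint m := by
  obtain h | ⟨m, hm, σ, -, h⟩ := h
  · exact absurd h (Set.singleton_ne_empty v)
  · have h1 := toPoint_mem_cell m σ
    rw [← h, Set.mem_singleton_iff] at h1
    exact ⟨m, hm, h1.symm⟩

lemma le_apply_of_mem_cell {m : Fin n →₀ ℕ} {σ : Finset (Fin n)} {x : Fin n → ℝ}
    (hx : x ∈ cell m σ) (j : Fin n) : (m j : ℝ) - (if j ∈ σ then 1 else 0) ≤ x j := by
  have h : cell m σ ⊆ {x | (m j : ℝ) - (if j ∈ σ then 1 else 0) ≤ x j} := by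
    refine convexHull_min ?_ (convex_halfSpace_ge (LinearMap.proj j).isLinear _)
    rintro _ ⟨τ, hτ, rfl⟩
    have h1 := le_move_apply m τ j
    have h2 : (m j : ℝ) ≤ move m τ j + if j ∈ τ then 1 else 0 := by exact_mod_cast h1
    have h3 : (if j ∈ τ then 1 else 0 : ℝ) ≤ if j ∈ σ then 1 else 0 := by
      by_cases h : j ∈ τ
      · rw [if_pos h, if_pos (hτ h)]
      · rw [if_neg h]
        split_ifs <;> norm_num
    simp only [Set.mem_ofPred_eq, toPoint]
    linarith
  exact h hx

/-- Every point of the cell has j-th coordinate at least m_j - [j ∈ σ]. The bound is attained at m →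
{j} if j ∈ σ and at m otherwise. -/
lemma cellLabel_cell (hstable : IsStronglyStable I) (hdeg : GeneratedInDegree I d)
    (hdet : IsDetermined I a) {m : Fin n →₀ ℕ} (hm : m ∈ minGens I) {σ : Finset (Fin n)}
    (hσ : σ ⊆ supp₁ m) :
    cellLabel (cellComplex I) (dualLabel a) (cell m σ) =
      (a - m) + ∑ j ∈ σ, Finsupp.single j 1 := by
  ext j
  rw [Finsupp.add_apply, sum_single_apply, Finsupp.tsub_apply]
  change (⨆ v : {v : Fin n → ℝ // {v} ∈ cellComplex I ∧ v ∈ cell m σ}, dualLabel a v.1 j) = _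
  have hvert : ∀ τ ⊆ σ, {toPoint (move m τ)} ∈ cellComplex I := fun τ hτ => by
    rw [← cell_empty]
    exact cell_mem_cellComplex (move_mem_minGens hstable hdeg hm (hτ.trans hσ))
      (Finset.empty_subset _)
  apply le_antisymm
  · refine ciSup_le' fun v => ?_
    obtain ⟨m', -, hv⟩ := exists_toPoint_of_singleton_mem v.2.1
    have h1 := le_apply_of_mem_cell v.2.2 j
    rw [hv, dualLabel_toPoint, Finsupp.tsub_apply]
    rw [hv, toPoint, sub_le_iff_le_add] at h1
    have h2 : m j ≤ m' j + if j ∈ σ then 1 else 0 := by exact_mod_cast h1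
    omega
  · have key : ∀ τ ⊆ σ, (a - move m τ) j ≤
        ⨆ v : {v : Fin n → ℝ // {v} ∈ cellComplex I ∧ v ∈ cell m σ}, dualLabel a v.1 j := by
      intro τ hτ
      rw [← dualLabel_toPoint]
      exact le_ciSup (bddAbove_dualLabel a
        (fun v : {v : Fin n → ℝ // {v} ∈ cellComplex I ∧ v ∈ cell m σ} => v.1) j)
        ⟨_, hvert τ hτ, toPoint_move_mem_cell hτ⟩
    split_ifs with hj
    -- Since m_j ≤ a_j, the truncated difference a_j - (m_j - 1) is indeed (a_j - m_j) + 1.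
    · refine le_trans ?_ (key {j} (Finset.singleton_subset_iff.2 hj))
      have h1 := move_singleton_apply_self (hσ hj)
      have h2 := hdet m hm j
      rw [Finsupp.tsub_apply]
      omega
    · simpa using key ∅ (Finset.empty_subset _)

end Complex

/-! ## Facets and incidence numbers -/

section Facets

variable {n : ℕ}

/-- The base point of the facet of `C(m, σ)` in direction `j`: `m` for the facet
`C(m, σ \ {j})` and `m → {j}` for the parallel one. -/
noncomputable def facetBase (m : Fin n →₀ ℕ) (j : Fin n) (b : Bool) : Fin n →₀ ℕ :=
  if b then move m {j} else m

/-- The sign by which the incidence number of a facet differs from the Koszul sign. -/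
def facetSign (b : Bool) : ℤ := if b then -1 else 1

lemma tail_facetBase {m : Fin n →₀ ℕ} {j : Fin n} (hj : j ∈ supp₁ m) (b : Bool) (i : Fin n) :
    tail (facetBase m j b) i = tail m i + if i = j ∧ b = true then 1 else 0 := by
  cases b
  · simp [facetBase]
  · simp [facetBase, tail_move (Finset.singleton_subset_iff.2 hj)]

lemma facetBase_injective {m : Fin n →₀ ℕ} {j : Fin n} (hj : j ∈ supp₁ m) {b b' : Bool}
    (h : facetBase m j b = facetBase m j b') : b = b' := by
  have h1 := tail_facetBase hj b j
  rw [h, tail_facetBase hj b' j] at h1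
  cases b <;> cases b' <;> simp at h1 ⊢

lemma erase_subset_supp₁_facetBase {m : Fin n →₀ ℕ} {σ : Finset (Fin n)} (hσ : σ ⊆ supp₁ m)
    {j : Fin n} (hj : j ∈ σ) (b : Bool) : σ.erase j ⊆ supp₁ (facetBase m j b) := by
  cases b
  · exact (Finset.erase_subset _ _).trans hσ
  · exact subset_supp₁_move ((Finset.erase_subset _ _).trans hσ)
      (Finset.singleton_subset_iff.2 (hσ hj)) (by simp)

lemma cell_facetBase_subset {m : Fin n →₀ ℕ} {σ : Finset (Fin n)} (hσ : σ ⊆ supp₁ m)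
    {j : Fin n} (hj : j ∈ σ) (b : Bool) : cell (facetBase m j b) (σ.erase j) ⊆ cell m σ := by
  rw [cell_subset_cell_iff hσ (erase_subset_supp₁_facetBase hσ hj b)]
  intro i
  rw [tail_facetBase (hσ hj)]
  by_cases hij : i = j
  · subst hij
    cases b <;> simp [hj]
  · simp [hij]

lemma isFacet_facetBase {m : Fin n →₀ ℕ} {σ : Finset (Fin n)} (hσ : σ ⊆ supp₁ m)
    {j : Fin n} (hj : j ∈ σ) (b : Bool) :
    IsFacet (cell (facetBase m j b) (σ.erase j)) (cell m σ) := by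
  refine ⟨cell_facetBase_subset hσ hj b, ?_⟩
  rw [cellDim_cell hσ, cellDim_cell (erase_subset_supp₁_facetBase hσ hj b),
    ← Finset.card_erase_add_one hj]
  push_cast
  rfl

/-- A subcube of codimension one fixes exactly one direction j, and b records whether at its larger
end. -/
lemma exists_facetBase_of_isFacet {m m' : Fin n →₀ ℕ} {σ σ' : Finset (Fin n)}
    (hσ : σ ⊆ supp₁ m) (hσ' : σ' ⊆ supp₁ m') (h : IsFacet (cell m' σ') (cell m σ)) :
    ∃ j ∈ σ, ∃ b, σ' = σ.erase j ∧ m' = facetBase m j b := by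
  obtain ⟨hsub, ρ, hρ, hd, rfl⟩ := exists_move_of_cell_subset hσ hσ' h.1
  have hcard := h.2
  rw [cellDim_cell hσ, cellDim_cell hσ'] at hcard
  have hcard' : (σ \ σ').card = 1 := by
    rw [Finset.card_sdiff_of_subset hsub]
    omega
  obtain ⟨j, hj⟩ := Finset.card_eq_one.1 hcard'
  have hjσ : j ∈ σ := (Finset.mem_sdiff.1 (hj ▸ Finset.mem_singleton_self j)).1
  have hρj : ρ ⊆ {j} := hj ▸ Finset.subset_sdiff.2 ⟨hρ, hd⟩
  refine ⟨j, hjσ, decide (j ∈ ρ), ?_, ?_⟩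
  · rw [← Finset.sdiff_singleton_eq_erase, ← hj, Finset.sdiff_sdiff_eq_self hsub]
  · rcases Finset.subset_singleton_iff.1 hρj with rfl | rfl <;> simp [facetBase]

lemma isFacet_empty_cell_iff {m : Fin n →₀ ℕ} {σ : Finset (Fin n)} (hσ : σ ⊆ supp₁ m) :
    IsFacet ∅ (cell m σ) ↔ σ = ∅ := by
  rw [IsFacet, cellDim_cell hσ, cellDim_empty]
  simp

lemma not_isFacet_empty (Q : Set (Fin n → ℝ)) : ¬IsFacet Q ∅ := by
  rintro ⟨h1, h2⟩
  rw [Set.subset_empty_iff.1 h1, cellDim_empty] at h2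
  omega

lemma incidence_empty {P : Set (Fin n → ℝ)} (h : cellDim P = 0) : incidence ∅ P = 1 := by
  rw [incidence, if_pos ⟨rfl, h⟩]

lemma IsUpperFacetData.eq {Q : Set (Fin n → ℝ)} {m m' : Fin n →₀ ℕ}
    {σ σ' : Finset (Fin n)} {j' : Fin n} (hσ : σ ⊆ supp₁ m)
    (h : IsUpperFacetData Q (cell m σ) m' σ' j') :
    m' = m ∧ σ' = σ ∧ j' ∈ σ ∧ Q = cell (facetBase m j' false) (σ.erase j') := by
  obtain ⟨h1, h2, h3, h4⟩ := h
  obtain ⟨rfl, rfl⟩ := cell_injective hσ h1 h3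
  exact ⟨rfl, rfl, h2, h4⟩

lemma IsLowerFacetData.eq {Q : Set (Fin n → ℝ)} {m m' : Fin n →₀ ℕ}
    {σ σ' : Finset (Fin n)} {j' : Fin n} (hσ : σ ⊆ supp₁ m)
    (h : IsLowerFacetData Q (cell m σ) m' σ' j') :
    m' = m ∧ σ' = σ ∧ j' ∈ σ ∧ Q = cell (facetBase m j' true) (σ.erase j') := by
  obtain ⟨h1, h2, h3, h4⟩ := h
  obtain ⟨rfl, rfl⟩ := cell_injective hσ h1 h3
  exact ⟨rfl, rfl, h2, h4⟩

lemma facetBase_cell_injective {m : Fin n →₀ ℕ} {σ : Finset (Fin n)} (hσ : σ ⊆ supp₁ m)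
    {j j' : Fin n} (hj : j ∈ σ) (hj' : j' ∈ σ) {b b' : Bool}
    (h : cell (facetBase m j b) (σ.erase j) = cell (facetBase m j' b') (σ.erase j')) :
    j = j' ∧ b = b' := by
  obtain ⟨h1, h2⟩ := cell_injective (erase_subset_supp₁_facetBase hσ hj b)
    (erase_subset_supp₁_facetBase hσ hj' b') h
  have hjj : j = j' := (Finset.erase_inj σ hj).1 h2
  subst hjj
  exact ⟨rfl, facetBase_injective (hσ hj) h1⟩

/-- The data in `incidence` are chosen, but a cell determines its pair and a facet determines (j,
b). So the choice is forced and the two cases exclude each other. -/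
lemma incidence_facetBase {m : Fin n →₀ ℕ} {σ : Finset (Fin n)} (hσ : σ ⊆ supp₁ m)
    {j : Fin n} (hj : j ∈ σ) (b : Bool) :
    incidence (cell (facetBase m j b) (σ.erase j)) (cell m σ) =
      facetSign b * koszulSign σ j := by
  rw [incidence, if_neg (fun h => (cell_nonempty _ _).ne_empty h.1)]
  cases b
  · have h : ∃ p : (Fin n →₀ ℕ) × Finset (Fin n) × Fin n, IsUpperFacetData
        (cell (facetBase m j false) (σ.erase j)) (cell m σ) p.1 p.2.1 p.2.2 :=
      ⟨(m, σ, j), hσ, hj, rfl, rfl⟩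
    rw [dif_pos h]
    obtain ⟨-, h2, h3, h4⟩ := h.choose_spec.eq hσ
    rw [h2, ← (facetBase_cell_injective hσ hj h3 h4).1]
    simp [facetSign]
  · have h' : ¬∃ p : (Fin n →₀ ℕ) × Finset (Fin n) × Fin n, IsUpperFacetData
        (cell (facetBase m j true) (σ.erase j)) (cell m σ) p.1 p.2.1 p.2.2 := by
      rintro ⟨p, hp⟩
      obtain ⟨-, -, h3, h4⟩ := hp.eq hσ
      exact Bool.noConfusion (facetBase_cell_injective hσ hj h3 h4).2
    have h : ∃ p : (Fin n →₀ ℕ) × Finset (Fin n) × Fin n, IsLowerFacetData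
        (cell (facetBase m j true) (σ.erase j)) (cell m σ) p.1 p.2.1 p.2.2 :=
      ⟨(m, σ, j), hσ, hj, rfl, rfl⟩
    rw [dif_neg h', dif_pos h]
    obtain ⟨-, h2, h3, h4⟩ := h.choose_spec.eq hσ
    rw [h2, ← (facetBase_cell_injective hσ hj h3 h4).1]
    simp [facetSign]

lemma incidence_eq_zero_of_not_isFacet {P Q : Set (Fin n → ℝ)} (h : ¬IsFacet Q P) :
    incidence Q P = 0 := by
  rw [incidence, if_neg, dif_neg, dif_neg]
  · rintro ⟨p, h1, h2, h3, h4⟩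
    rw [h3, h4] at h
    exact h (isFacet_facetBase h1 h2 true)
  · rintro ⟨p, h1, h2, h3, h4⟩
    rw [h3, h4] at h
    exact h (isFacet_facetBase h1 h2 false)
  · rintro ⟨rfl, h2⟩
    exact h ⟨Set.empty_subset _, by rw [h2, cellDim_empty]; rfl⟩

end Facets

/-! ### The sign relation around a face of codimension two -/

section Incidence

variable {K : Type*} [Field K] {n : ℕ} {I : Ideal (MvPolynomial (Fin n) K)}

lemma facetSign_mul_koszulSign_eq_one_or (b : Bool) (σ : Finset (Fin n)) (j : Fin n) :
    facetSign b * koszulSign σ j = 1 ∨ facetSign b * koszulSign σ j = -1 := by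
  rcases koszulSign_eq_one_or σ j with h | h <;> cases b <;> simp [h, facetSign]

lemma exists_cell_of_mem_of_isFacet {P Q : Set (Fin n → ℝ)} (hP : P ∈ cellComplex I)
    (h : IsFacet Q P) : ∃ m ∈ minGens I, ∃ σ ⊆ supp₁ m, P = cell m σ :=
  hP.resolve_left fun h' => not_isFacet_empty Q (h' ▸ h)

/-- Either S is empty and the two facets are the ends of an edge, with opposite signs, or S arises
by fixing two distinct directions in either order, and the Koszul signs of the two orders are
opposite. -/
lemma incidence_diamond {m : Fin n →₀ ℕ} {σ : Finset (Fin n)} (hσ : σ ⊆ supp₁ m)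
    {j₁ j₂ : Fin n} (hj₁ : j₁ ∈ σ) (hj₂ : j₂ ∈ σ) {b₁ b₂ : Bool}
    (hne : cell (facetBase m j₁ b₁) (σ.erase j₁) ≠ cell (facetBase m j₂ b₂) (σ.erase j₂))
    {S : Set (Fin n → ℝ)} (hS : S ∈ cellComplex I)
    (h₁ : IsFacet S (cell (facetBase m j₁ b₁) (σ.erase j₁)))
    (h₂ : IsFacet S (cell (facetBase m j₂ b₂) (σ.erase j₂))) :
    incidence (cell (facetBase m j₁ b₁) (σ.erase j₁)) (cell m σ) *
        incidence S (cell (facetBase m j₁ b₁) (σ.erase j₁)) +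
      incidence (cell (facetBase m j₂ b₂) (σ.erase j₂)) (cell m σ) *
        incidence S (cell (facetBase m j₂ b₂) (σ.erase j₂)) = 0 := by
  have hs₁ := erase_subset_supp₁_facetBase hσ hj₁ b₁
  have hs₂ := erase_subset_supp₁_facetBase hσ hj₂ b₂
  rw [incidence_facetBase hσ hj₁, incidence_facetBase hσ hj₂]
  rcases hS with rfl | ⟨m', -, σ', hσ', rfl⟩
  · rw [isFacet_empty_cell_iff hs₁] at h₁
    rw [isFacet_empty_cell_iff hs₂] at h₂
    have hj : j₁ = j₂ := (Finset.erase_inj σ hj₁).1 (h₁.trans h₂.symm)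
    subst hj
    rw [incidence_empty (by rw [cellDim_cell hs₁, h₁]; rfl),
      incidence_empty (by rw [cellDim_cell hs₂, h₁]; rfl)]
    have hb : b₁ ≠ b₂ := fun h => hne (by rw [h])
    cases b₁ <;> cases b₂ <;> simp [facetSign] at hb ⊢
  · obtain ⟨l₁, hl₁, c₁, rfl, hm₁⟩ := exists_facetBase_of_isFacet hs₁ hσ' h₁
    obtain ⟨l₂, hl₂, c₂, he, hm₂⟩ := exists_facetBase_of_isFacet hs₂ hσ' h₂
    have hl₁' := Finset.mem_erase.1 hl₁
    have hl₂' := Finset.mem_erase.1 hl₂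
    have htail : ∀ i, (tail m i + if i = j₁ ∧ b₁ = true then 1 else 0) +
        (if i = l₁ ∧ c₁ = true then 1 else 0) =
        (tail m i + if i = j₂ ∧ b₂ = true then 1 else 0) +
        (if i = l₂ ∧ c₂ = true then 1 else 0) := by
      intro i
      rw [← tail_facetBase (hσ hj₁), ← tail_facetBase (hσ hj₂), ← tail_facetBase (hs₁ hl₁),
        ← tail_facetBase (hs₂ hl₂), ← hm₁, ← hm₂]
    by_cases hj : j₁ = j₂
    · subst hj
      have hl : l₁ = l₂ := (Finset.erase_inj _ hl₁).1 he
      subst hl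
      -- Parallel facets have no common face S: its coordinate j₁ would be at both ends.
      have h := htail j₁
      have hb : b₁ ≠ b₂ := fun h => hne (by rw [h])
      cases b₁ <;> cases b₂ <;> simp [hl₁'.1.symm] at hb h
    -- Removing j₁, l₁ or j₂, l₂ from σ leaves the same set, so with j₁ ≠ j₂ the two pairs agree
    -- crosswise. The end at which S is fixed in each direction then identifies the flags.
    · have h21 : l₂ = j₁ := by
        by_contra h
        have : j₁ ∈ ((σ.erase j₁).erase l₁) := by
          rw [he]
          simp [hj, hj₁, Ne.symm h]
        simp at this
      have h12 : l₁ = j₂ := by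
        by_contra h
        have : j₂ ∈ ((σ.erase j₂).erase l₂) := by
          rw [← he]
          simp [Ne.symm hj, hj₂, Ne.symm h]
        simp at this
      subst h21 h12
      have hb₁ : b₁ = c₂ := by
        have h := htail l₂
        cases b₁ <;> cases c₂ <;> simp [hj] at h ⊢
      have hb₂ : c₁ = b₂ := by
        have h := htail l₁
        cases c₁ <;> cases b₂ <;> simp [Ne.symm hj] at h ⊢
      subst hb₁ hb₂
      conv_lhs => enter [1, 2]; rw [hm₁, incidence_facetBase hs₁ hl₁]
      conv_lhs => enter [2, 2]; rw [hm₂, he, incidence_facetBase hs₂ hl₂]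
      have h := koszulSign_antisymm hj₁ hj₂ hj
      linear_combination (facetSign b₁ * facetSign c₁) * h

lemma isIncidenceFunction_incidence :
    IsIncidenceFunction (cellComplex I) incidence where
  facet := by
    intro P hP Q hQ h
    obtain ⟨m, -, σ, hσ, rfl⟩ := exists_cell_of_mem_of_isFacet hP h
    rcases hQ with rfl | ⟨m', -, σ', hσ', rfl⟩
    · rw [isFacet_empty_cell_iff hσ] at h
      exact Or.inl (incidence_empty (by rw [cellDim_cell hσ, h]; rfl))
    · obtain ⟨j, hj, b, rfl, rfl⟩ := exists_facetBase_of_isFacet hσ hσ' h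
      rw [incidence_facetBase hσ hj]
      exact facetSign_mul_koszulSign_eq_one_or b σ j
  not_facet := fun _ _ _ _ h => incidence_eq_zero_of_not_isFacet h
  vertex := fun _ _ h => incidence_empty h
  diamond := by
    intro P hP Q₁ hQ₁ Q₂ hQ₂ S hS hne h₁ h₂ hS₁ hS₂
    obtain ⟨m, -, σ, hσ, rfl⟩ := exists_cell_of_mem_of_isFacet hP h₁
    obtain ⟨m₁, -, σ₁, hσ₁, rfl⟩ := exists_cell_of_mem_of_isFacet hQ₁ hS₁
    obtain ⟨m₂, -, σ₂, hσ₂, rfl⟩ := exists_cell_of_mem_of_isFacet hQ₂ hS₂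
    obtain ⟨j₁, hj₁, b₁, rfl, rfl⟩ := exists_facetBase_of_isFacet hσ hσ₁ h₁
    obtain ⟨j₂, hj₂, b₂, rfl, rfl⟩ := exists_facetBase_of_isFacet hσ hσ₂ h₂
    exact incidence_diamond hσ hj₁ hj₂ hne hS hS₁ hS₂

end Incidence

/-! ## The complex on pairs `(m, σ)` -/

section PairComplex

variable {K : Type*} [Field K] {n : ℕ}

variable (K n) in
/-- The free module on all pairs `(m, σ)`. -/
abbrev PairModule : Type _ := ((Fin n →₀ ℕ) × Finset (Fin n)) →₀ MvPolynomial (Fin n) K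

variable (K n) in
/-- The cellular differential in terms of pairs `(m, σ)`. -/
noncomputable def pairDifferential : PairModule K n →ₗ[MvPolynomial (Fin n) K] PairModule K n :=
  Finsupp.linearCombination (MvPolynomial (Fin n) K) (fun p =>
    ∑ j ∈ p.2, koszulSign p.2 j • (Finsupp.single (p.1, p.2.erase j) (X j) -
      Finsupp.single (move p.1 {j}, p.2.erase j) (X (prev j))))

variable (K) in
/-- The differential from the vertices to the empty cell in terms of pairs `(m, σ)`. -/
noncomputable def pairAugmentation (a : Fin n →₀ ℕ) :
    PairModule K n →ₗ[MvPolynomial (Fin n) K] MvPolynomial (Fin n) K :=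
  Finsupp.linearCombination (MvPolynomial (Fin n) K) (fun p => monomial (a - p.1) 1)

/-- The pairs that index the cells of dimension `k`. -/
def validPairs (G : Set (Fin n →₀ ℕ)) (k : ℕ) : Set ((Fin n →₀ ℕ) × Finset (Fin n)) :=
  {p | p.1 ∈ G ∧ p.2 ⊆ supp₁ p.1 ∧ p.2.card = k}

lemma pairDifferential_single (p : (Fin n →₀ ℕ) × Finset (Fin n)) (r : MvPolynomial (Fin n) K) :
    pairDifferential K n (Finsupp.single p r) =
      ∑ j ∈ p.2, koszulSign p.2 j • (Finsupp.single (p.1, p.2.erase j) (r * X j) -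
        Finsupp.single (move p.1 {j}, p.2.erase j) (r * X (prev j))) := by
  rw [pairDifferential, Finsupp.linearCombination_single, Finset.smul_sum]
  refine Finset.sum_congr rfl fun j _ => ?_
  rw [smul_comm, smul_sub, Finsupp.smul_single, Finsupp.smul_single, smul_eq_mul, smul_eq_mul]

variable {G : Set (Fin n →₀ ℕ)} {k : ℕ}

lemma erase_mem_validPairs {p : (Fin n →₀ ℕ) × Finset (Fin n)} (hp : p ∈ validPairs G (k + 1))
    {j : Fin n} (hj : j ∈ p.2) : (p.1, p.2.erase j) ∈ validPairs G k :=
  ⟨hp.1, (Finset.erase_subset _ _).trans hp.2.1, by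
    rw [Finset.card_erase_of_mem hj, hp.2.2, Nat.add_sub_cancel]⟩

lemma erase_subset_supp₁_move {m : Fin n →₀ ℕ} {σ : Finset (Fin n)} (hσ : σ ⊆ supp₁ m)
    {j : Fin n} (hj : j ∈ σ) : σ.erase j ⊆ supp₁ (move m {j}) :=
  subset_supp₁_move ((Finset.erase_subset _ _).trans hσ)
    (Finset.singleton_subset_iff.2 (hσ hj)) (by simp)

lemma move_mem_validPairs (hG : ∀ m ∈ G, ∀ j ∈ supp₁ m, move m {j} ∈ G)
    {p : (Fin n →₀ ℕ) × Finset (Fin n)} (hp : p ∈ validPairs G (k + 1))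
    {j : Fin n} (hj : j ∈ p.2) : (move p.1 {j}, p.2.erase j) ∈ validPairs G k :=
  ⟨hG _ hp.1 _ (hp.2.1 hj), erase_subset_supp₁_move hp.2.1 hj, by
    rw [Finset.card_erase_of_mem hj, hp.2.2, Nat.add_sub_cancel]⟩

lemma map_mem_of_supported {R M : Type*} [CommRing R] {ι : Type*} [AddCommGroup M] [Module R M]
    {s : Set ι} (f : (ι →₀ R) →ₗ[R] M) (S : Submodule R M)
    (h : ∀ p ∈ s, f (Finsupp.single p 1) ∈ S) {v : ι →₀ R} (hv : v ∈ Finsupp.supported R R s) :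
    f v ∈ S := by
  rw [Finsupp.supported_eq_span_single] at hv
  induction hv using Submodule.span_induction with
  | mem x hx => obtain ⟨p, hp, rfl⟩ := hx; exact h p hp
  | zero => simp
  | add x y _ _ hx hy => rw [map_add]; exact S.add_mem hx hy
  | smul r x _ hx => rw [map_smul]; exact S.smul_mem r hx

lemma pairDifferential_mem_supported (hG : ∀ m ∈ G, ∀ j ∈ supp₁ m, move m {j} ∈ G)
    {v : PairModule K n} (hv : v ∈ Finsupp.supported _ (MvPolynomial (Fin n) K)
      (validPairs G (k + 1))) :
    pairDifferential K n v ∈ Finsupp.supported (MvPolynomial (Fin n) K) (MvPolynomial (Fin n) K)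
      (validPairs G k) := by
  refine map_mem_of_supported _ _ (fun p hp => ?_) hv
  rw [pairDifferential_single]
  refine Submodule.sum_mem _ fun j hj => zsmul_mem (Submodule.sub_mem _ ?_ ?_) _
  · exact Finsupp.single_mem_supported _ _ (erase_mem_validPairs hp hj)
  · exact Finsupp.single_mem_supported _ _ (move_mem_validPairs hG hp hj)

/-- The contributions of (j, l) and (l, j) cancel: the steps at j and l commute and the Koszul signs
are antisymmetric. -/
lemma pairDifferential_pairDifferential {v : PairModule K n}
    (hv : v ∈ Finsupp.supported _ (MvPolynomial (Fin n) K) (validPairs G k)) :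
    pairDifferential K n (pairDifferential K n v) = 0 := by
  refine (Submodule.mem_bot (MvPolynomial (Fin n) K)).1 (map_mem_of_supported
    (pairDifferential K n ∘ₗ pairDifferential K n) ⊥ (fun p hp => ?_) hv)
  rw [Submodule.mem_bot, LinearMap.comp_apply, pairDifferential_single, map_sum]
  have h1 : ∀ j ∈ p.2, pairDifferential K n (koszulSign p.2 j •
      (Finsupp.single (p.1, p.2.erase j) (1 * X j) -
        Finsupp.single (move p.1 {j}, p.2.erase j) (1 * X (prev j)))) =
      ∑ l ∈ p.2.erase j, (koszulSign p.2 j * koszulSign (p.2.erase j) l) •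
        ((Finsupp.single (p.1, (p.2.erase j).erase l) (X j * X l) -
          Finsupp.single (move p.1 {l}, (p.2.erase j).erase l) (X j * X (prev l))) -
        (Finsupp.single (move p.1 {j}, (p.2.erase j).erase l) (X (prev j) * X l) -
          Finsupp.single (move (move p.1 {j}) {l}, (p.2.erase j).erase l)
            (X (prev j) * X (prev l)))) := by
    intro j _
    rw [map_zsmul, map_sub, pairDifferential_single, pairDifferential_single,
      ← Finset.sum_sub_distrib, Finset.smul_sum]
    refine Finset.sum_congr rfl fun l _ => ?_
    dsimp only
    rw [← zsmul_sub, smul_smul, one_mul, one_mul]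
  rw [Finset.sum_congr rfl h1, Finset.sum_sigma']
  refine Finset.sum_involution (fun x _ => ⟨x.2, x.1⟩) ?_ ?_ ?_ ?_
  · rintro ⟨j, l⟩ h
    rw [Finset.mem_sigma, Finset.mem_erase] at h
    obtain ⟨hj, hlj, hl⟩ := h
    dsimp only at hj hlj hl ⊢
    rw [koszulSign_antisymm hj hl (Ne.symm hlj), Finset.erase_right_comm,
      step_comm (hp.2.1 hj) (hp.2.1 hl) (Ne.symm hlj), mul_comm (X j) (X l),
      mul_comm (X j) (X (prev l)), mul_comm (X (prev j)) (X l),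
      mul_comm (X (prev j)) (X (prev l)), neg_smul, neg_add_eq_zero]
    congr 1
    abel
  · rintro ⟨j, l⟩ h _ h'
    rw [Finset.mem_sigma, Finset.mem_erase] at h
    exact h.2.1 (congrArg Sigma.fst h')
  · rintro ⟨j, l⟩ h
    simp only [Finset.mem_sigma, Finset.mem_erase] at h ⊢
    exact ⟨h.2.2, Ne.symm h.2.1, h.1⟩
  · intro _ _
    rfl

/-- Both sides are x^a x_j / m; the subtractions are exact because both generators divide x^a. -/
lemma X_mul_monomial_sub {a m : Fin n →₀ ℕ} {j : Fin n} (hj : j ∈ supp₁ m) (hm : m ≤ a)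
    (hm' : move m {j} ≤ a) : (X j * monomial (a - m) 1 : MvPolynomial (Fin n) K) =
      X (prev j) * monomial (a - move m {j}) 1 := by
  rw [X, X, monomial_mul, monomial_mul]
  congr 2
  have h := step_add hj
  ext i
  have h1 := DFunLike.congr_fun h i
  have h2 := hm i
  have h3 := hm' i
  simp only [Finsupp.add_apply, Finsupp.tsub_apply] at *
  omega

lemma pairAugmentation_pairDifferential {a : Fin n →₀ ℕ} (ha : ∀ m ∈ G, m ≤ a)
    (hG : ∀ m ∈ G, ∀ j ∈ supp₁ m, move m {j} ∈ G) {v : PairModule K n}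
    (hv : v ∈ Finsupp.supported _ (MvPolynomial (Fin n) K) (validPairs G k)) :
    pairAugmentation K a (pairDifferential K n v) = 0 := by
  refine (Submodule.mem_bot (MvPolynomial (Fin n) K)).1 (map_mem_of_supported
    (pairAugmentation K a ∘ₗ pairDifferential K n) ⊥ (fun p hp => ?_) hv)
  rw [Submodule.mem_bot, LinearMap.comp_apply, pairDifferential_single, map_sum]
  refine Finset.sum_eq_zero fun j hj => ?_
  rw [map_zsmul, map_sub, pairAugmentation, Finsupp.linearCombination_single,
    Finsupp.linearCombination_single, one_mul, one_mul, smul_eq_mul, smul_eq_mul,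
    X_mul_monomial_sub (hp.2.1 hj) (ha _ hp.1) (ha _ (hG _ hp.1 _ (hp.2.1 hj))), sub_self,
    smul_zero]

/-! ### Reduction to a normal form modulo boundaries -/

/-- The term `x^u (m, σ)` is reduced if the largest `i ≥ 2` for which `x_i` divides `m` and
`x^u x^σ` is in `σ`, or if there is no such `i`. -/
def IsReducedTerm (u m : Fin n →₀ ℕ) (σ : Finset (Fin n)) : Prop :=
  (∃ μ ∈ σ, ∀ i, μ < i → i ∉ σ ∧ (m i = 0 ∨ u i = 0)) ∨
    (σ = ∅ ∧ ∀ i : Fin n, (i : ℕ) ≠ 0 → m i = 0 ∨ u i = 0)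

/-- The largest i ∈ supp₁(m) with i ∈ σ or x_i dividing x^u decides. If it is outside σ, it is the
direction in which the term can be rewritten. -/
lemma isReducedTerm_or_exists {u m : Fin n →₀ ℕ} {σ : Finset (Fin n)} (hσ : σ ⊆ supp₁ m) :
    IsReducedTerm u m σ ∨ ∃ μ ∈ supp₁ m, μ ∉ σ ∧ u μ ≠ 0 ∧
      ∀ i, μ < i → i ∉ σ ∧ (m i = 0 ∨ u i = 0) := by
  by_cases hS : ((supp₁ m).filter (fun i => u i ≠ 0 ∨ i ∈ σ)).Nonempty
  · set μ := Finset.max' _ hS with hμ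
    obtain ⟨h1, h2⟩ := Finset.mem_filter.1 (Finset.max'_mem _ hS)
    rw [← hμ] at h1 h2
    have h3 : ∀ i, μ < i → i ∉ σ ∧ (m i = 0 ∨ u i = 0) := by
      intro i hi
      have h4 : i ∉ (supp₁ m).filter (fun i => u i ≠ 0 ∨ i ∈ σ) := fun h =>
        (Finset.le_max' _ i h).not_gt hi
      rw [Finset.mem_filter] at h4
      have h5 : i ∉ σ := fun h => h4 ⟨hσ h, Or.inr h⟩
      refine ⟨h5, ?_⟩
      by_contra! h6
      refine h4 ⟨mem_supp₁.2 ⟨h6.1, ?_⟩, Or.inl h6.2⟩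
      rw [Fin.lt_def] at hi
      omega
    by_cases h4 : μ ∈ σ
    · exact Or.inl (Or.inl ⟨μ, h4, h3⟩)
    · exact Or.inr ⟨μ, h1, h4, h2.resolve_right h4, h3⟩
  · rw [Finset.not_nonempty_iff_eq_empty, Finset.filter_eq_empty_iff] at hS
    refine Or.inl (Or.inr ⟨Finset.eq_empty_of_forall_notMem fun i hi =>
      hS (hσ hi) (Or.inr hi), fun i hi => ?_⟩)
    by_contra! h
    exact hS (mem_supp₁.2 ⟨h.1, hi⟩) (Or.inl h.2)

variable (K n) in
/-- The elements all of whose terms are reduced. -/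
noncomputable def reducedElements : AddSubgroup (PairModule K n) where
  carrier := {v | ∀ p u, coeff u (v p) ≠ 0 → IsReducedTerm u p.1 p.2}
  zero_mem' := by intro p u h; simp at h
  add_mem' := by
    intro v w hv hw p u h
    rw [Finsupp.add_apply, coeff_add] at h
    by_cases h1 : coeff u (v p) = 0
    · exact hw p u (by simpa [h1] using h)
    · exact hv p u h1
  neg_mem' := by
    intro v hv p u h
    exact hv p u (by simpa using h)

lemma single_mem_reducedElements {u m : Fin n →₀ ℕ} {σ : Finset (Fin n)}
    (h : IsReducedTerm u m σ) (c : K) :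
    Finsupp.single (m, σ) (monomial u c) ∈ reducedElements K n := by
  intro p w hw
  rw [Finsupp.single_apply] at hw
  split_ifs at hw with hp
  · rw [coeff_monomial] at hw
    split_ifs at hw with hu
    · subst hp hu
      exact h
    · exact absurd rfl hw
  · simp at hw

/-- Induction on the energy of m: modulo the boundary of a multiple of (m, σ ∪ μ), a factor x_μ at
(m, σ) is traded for x_{μ-1} at (m → μ, σ), up to reduced terms. -/
lemma exists_sub_mem_reducedElements_single (hG : ∀ m ∈ G, ∀ j ∈ supp₁ m, move m {j} ∈ G)
    (u m : Fin n →₀ ℕ) (σ : Finset (Fin n)) (hp : (m, σ) ∈ validPairs G k) (c : K) :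
    ∃ w ∈ Finsupp.supported (MvPolynomial (Fin n) K) (MvPolynomial (Fin n) K)
        (validPairs G (k + 1)),
      Finsupp.single (m, σ) (monomial u c) - pairDifferential K n w ∈ reducedElements K n := by
  induction hN : energy m using Nat.strong_induction_on generalizing m u with
  | _ N ih =>
  obtain hred | ⟨μ, hμm, hμσ, hu, hμ⟩ := isReducedTerm_or_exists (u := u) hp.2.1
  · exact ⟨0, Submodule.zero_mem _, by simpa using single_mem_reducedElements hred c⟩
  have hp' : (m, insert μ σ) ∈ validPairs G (k + 1) :=
    ⟨hp.1, Finset.insert_subset hμm hp.2.1, by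
      have := hp.2.2
      simp only at this ⊢
      rw [Finset.card_insert_of_notMem hμσ, this]⟩
  have hpμ : (move m {μ}, σ) ∈ validPairs G k := by
    simpa [Finset.erase_insert hμσ] using move_mem_validPairs hG hp' (Finset.mem_insert_self μ σ)
  have hE : energy (move m {μ}) < N := by
    have := energy_step hμm
    exact hN ▸ Nat.lt_of_succ_le this.le
  obtain ⟨w, hw, hw'⟩ := ih (energy (move m {μ})) hE
    (u - Finsupp.single μ 1 + Finsupp.single (prev μ) 1) (move m {μ}) hpμ rfl
  set s := koszulSign (insert μ σ) μ with hs
  -- The factor s makes the coefficient of (m, σ) in the boundary exactly c x^u, because s² = 1.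
  set w₀ : PairModule K n :=
    s • Finsupp.single (m, insert μ σ) (monomial (u - Finsupp.single μ 1) c) with hw₀
  have hu' : u - Finsupp.single μ 1 + Finsupp.single μ 1 = u :=
    tsub_add_cancel_of_le (Finsupp.single_le_iff.2 (Nat.one_le_iff_ne_zero.2 hu))
  -- Every j ∈ σ is below μ, so neither the move at j nor the factors x_j and x_{j-1} affect
  -- anything above μ. As μ stays in the index set, it witnesses that these terms are reduced.
  have hrest : ∀ j ∈ σ, koszulSign (insert μ σ) j •
      (Finsupp.single (m, (insert μ σ).erase j)
          (monomial (u - Finsupp.single μ 1) c * X j : MvPolynomial (Fin n) K) -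
        Finsupp.single (move m {j}, (insert μ σ).erase j)
          (monomial (u - Finsupp.single μ 1) c * X (prev j))) ∈ reducedElements K n := by
    intro j hj
    have hjμ : j < μ := lt_of_le_of_ne (not_lt.1 fun h => (hμ j h).1 hj)
      (fun h => hμσ (h ▸ hj))
    have hpj := prev_lt (mem_supp₁.1 (hp.2.1 hj)).2
    refine zsmul_mem (sub_mem ?_ ?_) _
    · rw [X, monomial_mul, mul_one]
      refine single_mem_reducedElements (Or.inl ⟨μ, by simp [hjμ.ne'], fun i hi => ⟨?_, ?_⟩⟩) c
      · simp [hi.ne', (hμ i hi).1]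
      · have h1 : (Finsupp.single j 1 : Fin n →₀ ℕ) i = 0 := by
          simp [(hjμ.trans hi).ne]
        rw [Finsupp.add_apply, Finsupp.tsub_apply, h1]
        exact (hμ i hi).2.imp_right fun h => by rw [h, zero_tsub]
    · rw [X, monomial_mul, mul_one]
      refine single_mem_reducedElements (Or.inl ⟨μ, by simp [hjμ.ne'], fun i hi => ⟨?_, ?_⟩⟩) c
      · simp [hi.ne', (hμ i hi).1]
      · have h1 : (Finsupp.single (prev j) 1 : Fin n →₀ ℕ) i = 0 := by
          simp [(hpj.trans (hjμ.trans hi)).ne]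
        have h2 := DFunLike.congr_fun (step_add (hp.2.1 hj)) i
        rw [Finsupp.add_apply, Finsupp.add_apply, h1] at h2
        rw [Finsupp.add_apply, Finsupp.tsub_apply, h1]
        exact (hμ i hi).2.imp (fun h => (Nat.add_eq_zero_iff.1 (h2.trans h)).1) fun h => by rw [h, zero_tsub]
  refine ⟨w₀ + w, Submodule.add_mem _ (zsmul_mem (Finsupp.single_mem_supported _ _ hp') _) hw, ?_⟩
  have key : pairDifferential K n w₀ = Finsupp.single (m, σ) (monomial u c) -
      Finsupp.single (move m {μ}, σ)
        (monomial (u - Finsupp.single μ 1 + Finsupp.single (prev μ) 1) c) +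
      s • ∑ j ∈ σ, koszulSign (insert μ σ) j •
        (Finsupp.single (m, (insert μ σ).erase j)
            (monomial (u - Finsupp.single μ 1) c * X j) -
          Finsupp.single (move m {j}, (insert μ σ).erase j)
            (monomial (u - Finsupp.single μ 1) c * X (prev j))) := by
    rw [hw₀, map_zsmul, pairDifferential_single, Finset.sum_insert hμσ, smul_add, smul_smul,
      ← hs, koszulSign_mul_self, one_smul, Finset.erase_insert hμσ, X, X, monomial_mul,
      monomial_mul, mul_one, hu']
  rw [map_add, key]
  have h := sub_mem hw' (zsmul_mem (sum_mem hrest) s)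
  convert h using 1
  abel

/-- Multiplication by a variable can destroy reducedness, so the extension from single terms is by
additivity only. -/
lemma exists_sub_mem_reducedElements (hG : ∀ m ∈ G, ∀ j ∈ supp₁ m, move m {j} ∈ G)
    {v : PairModule K n}
    (hv : v ∈ Finsupp.supported _ (MvPolynomial (Fin n) K) (validPairs G k)) :
    ∃ w ∈ Finsupp.supported (MvPolynomial (Fin n) K) (MvPolynomial (Fin n) K)
        (validPairs G (k + 1)), v - pairDifferential K n w ∈ reducedElements K n := by
  have hadd : ∀ v v' : PairModule K n,
      (∃ w ∈ Finsupp.supported (MvPolynomial (Fin n) K) (MvPolynomial (Fin n) K)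
        (validPairs G (k + 1)), v - pairDifferential K n w ∈ reducedElements K n) →
      (∃ w ∈ Finsupp.supported (MvPolynomial (Fin n) K) (MvPolynomial (Fin n) K)
        (validPairs G (k + 1)), v' - pairDifferential K n w ∈ reducedElements K n) →
      (∃ w ∈ Finsupp.supported (MvPolynomial (Fin n) K) (MvPolynomial (Fin n) K)
        (validPairs G (k + 1)), v + v' - pairDifferential K n w ∈ reducedElements K n) := by
    rintro v v' ⟨w, hw, h⟩ ⟨w', hw', h'⟩
    refine ⟨w + w', Submodule.add_mem _ hw hw', ?_⟩
    rw [map_add, add_sub_add_comm]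
    exact add_mem h h'
  rw [← Finsupp.sum_single v]
  refine Finset.sum_induction _ _ hadd ⟨0, Submodule.zero_mem _, by simp⟩ fun p hp => ?_
  induction v p using MvPolynomial.induction_on' with
  | monomial u c =>
    exact exists_sub_mem_reducedElements_single hG u p.1 p.2 (hv hp) c
  | add f g hf hg =>
    rw [Finsupp.single_add]
    exact hadd _ _ hf hg

/-! ### Reduced cycles vanish -/

/-- Only x^u (m, σ) contributes to x^u x_μ (m, σ \ μ). A facet based at m' → j has energy below that
of m. A facet (m, σ' \ j) with j ≠ μ would come from the reduced term (x^u x_μ / x_j) (m, σ') with μ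
∉ σ', which is contradictory. -/
lemma coeff_pairDifferential_term_eq_zero {v : PairModule K n} (hv : v ∈ reducedElements K n)
    (hvalid : v ∈ Finsupp.supported _ (MvPolynomial (Fin n) K) (validPairs G k))
    {m u : Fin n →₀ ℕ} {σ : Finset (Fin n)} {μ : Fin n} (hσ : σ ⊆ supp₁ m) (hμσ : μ ∈ σ)
    (hμ : ∀ i, μ < i → i ∉ σ ∧ (m i = 0 ∨ u i = 0))
    {p : (Fin n →₀ ℕ) × Finset (Fin n)} (hp : p ∈ v.support) (hE : energy p.1 ≤ energy m)
    {j : Fin n} (hj : j ∈ p.2) (hne : ¬(p = (m, σ) ∧ j = μ)) :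
    coeff (u + Finsupp.single μ 1) ((koszulSign p.2 j • (Finsupp.single (p.1, p.2.erase j)
        (v p * X j) - Finsupp.single (move p.1 {j}, p.2.erase j) (v p * X (prev j))) :
      PairModule K n) (m, σ.erase μ)) = 0 := by
  obtain ⟨m', σ'⟩ := p
  obtain ⟨-, hσ', -⟩ := hvalid hp
  dsimp only at *
  have h1 : (move m' {j}, σ'.erase j) ≠ (m, σ.erase μ) := by
    intro h
    have := energy_step (hσ' hj)
    rw [(Prod.mk.inj h).1] at this
    omega
  rw [Finsupp.smul_apply, Finsupp.sub_apply, Finsupp.single_eq_of_ne' h1, sub_zero, coeff_smul,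
    Finsupp.single_apply]
  split_ifs with h2
  swap
  · simp
  rw [Prod.mk.injEq] at h2
  obtain ⟨rfl, h2⟩ := h2
  suffices h : coeff (u + Finsupp.single μ 1) (v (m', σ') * X j) = 0 by rw [h, smul_zero]
  rw [coeff_mul_X']
  split_ifs with hju
  swap
  · rfl
  by_contra hc
  by_cases hjμ : j = μ
  · subst hjμ
    refine hne ⟨?_, rfl⟩
    rw [← Finset.insert_erase hj, h2, Finset.insert_erase hμσ]
  have hmem : ∀ i ∈ σ', i ≠ j → i ∈ σ ∧ i ≠ μ := fun i hi hij => by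
    have : i ∈ σ.erase μ := h2 ▸ Finset.mem_erase.2 ⟨hij, hi⟩
    exact (Finset.mem_erase.1 this).symm
  obtain ⟨μ', hμ', hlt⟩ | ⟨h0, -⟩ := hv _ _ hc
  swap
  · simp only at h0
    simp [h0] at hj
  dsimp only at hμ' hlt
  -- The witness μ' of that term cannot be below μ, since x_μ divides both m and the monomial; it is
  -- not μ, since μ ∉ σ'; above μ it could only be j, but then x_j does not divide x^u x_μ.
  rcases lt_trichotomy μ' μ with h | h | h
  · rcases (hlt μ h).2 with h3 | h3
    · exact (mem_supp₁.1 (hσ hμσ)).1 h3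
    · simp [hjμ] at h3
  · subst h
    exact (hmem _ hμ' (Ne.symm hjμ)).2 rfl
  · have hj' : μ' = j := by
      by_contra h3
      exact (hμ _ h).1 (hmem _ hμ' h3).1
    subst hj'
    have h4 := (hμ _ h).2.resolve_left (mem_supp₁.1 (hσ' hj)).1
    simp [h4, h.ne] at hju

/-- A pair of maximal energy in the support yields a boundary term that nothing cancels. Positive
dimension excludes the case σ = ∅ of `IsReducedTerm`. -/
lemma eq_zero_of_pairDifferential_eq_zero {v : PairModule K n} (hv : v ∈ reducedElements K n)
    (hvalid : v ∈ Finsupp.supported _ (MvPolynomial (Fin n) K) (validPairs G (k + 1)))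
    (h0 : pairDifferential K n v = 0) : v = 0 := by
  by_contra hne
  obtain ⟨⟨m, σ⟩, hp, hmax⟩ := Finset.exists_max_image v.support (fun p => energy p.1)
    (Finsupp.support_nonempty_iff.2 hne)
  obtain ⟨u, hu⟩ := MvPolynomial.ne_zero_iff.1 (Finsupp.mem_support_iff.1 hp)
  obtain ⟨-, hσ, hcard⟩ := hvalid hp
  obtain ⟨μ, hμσ, hμ⟩ | ⟨h, -⟩ := hv _ _ hu
  swap
  · simp only at h hcard
    simp [h] at hcard
  dsimp only at hσ hcard hμσ hμ hmax
  have h1 : coeff (u + Finsupp.single μ 1) (pairDifferential K n v (m, σ.erase μ)) = 0 := by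
    rw [h0]; simp
  rw [← Finsupp.sum_single v, Finsupp.sum, map_sum, Finsupp.finsetSum_apply, coeff_sum,
    Finset.sum_eq_single_of_mem _ hp, pairDifferential_single, Finsupp.finsetSum_apply, coeff_sum,
    Finset.sum_eq_single_of_mem μ hμσ] at h1
  · have h2 : (move m {μ}, σ.erase μ) ≠ (m, σ.erase μ) := by
      intro h
      have := energy_step (hσ hμσ)
      rw [(Prod.mk.inj h).1] at this
      omega
    dsimp only at h1
    rw [Finsupp.smul_apply, Finsupp.sub_apply, Finsupp.single_eq_same,
      Finsupp.single_eq_of_ne' h2, sub_zero, coeff_smul, coeff_mul_X] at h1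
    rcases koszulSign_eq_one_or σ μ with h | h
    · rw [h, one_smul] at h1
      exact hu h1
    · rw [h, neg_smul, one_smul, neg_eq_zero] at h1
      exact hu h1
  · intro j hj hjμ
    exact coeff_pairDifferential_term_eq_zero hv hvalid hσ hμσ hμ hp le_rfl hj
      (fun h => hjμ h.2)
  · intro p hp' hne'
    rw [pairDifferential_single, Finsupp.finsetSum_apply, coeff_sum]
    refine Finset.sum_eq_zero fun j hj => ?_
    exact coeff_pairDifferential_term_eq_zero hv hvalid hσ hμσ hμ hp' (hmax p hp') hj
      (fun h => hne' h.1)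

lemma eq_of_forall_ne_zero {m m' : Fin n →₀ ℕ} (hd : m.degree = m'.degree)
    (h : ∀ i : Fin n, (i : ℕ) ≠ 0 → m i = m' i) : m = m' := by
  ext i
  by_cases hi : (i : ℕ) = 0
  · rw [Finsupp.degree_eq_sum, Finsupp.degree_eq_sum,
      ← Finset.add_sum_erase _ _ (Finset.mem_univ i),
      ← Finset.add_sum_erase _ m' (Finset.mem_univ i),
      Finset.sum_congr rfl (g := m') fun j hj => h j fun hj' =>
        (Finset.mem_erase.1 hj).1 (Fin.ext (hj'.trans hi.symm))] at hd
    exact add_right_cancel hd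
  · exact h i hi

/-- Outside x_1 the exponents u and m have disjoint supports, so u - m determines them there; the
degree fixes the remaining exponent of m. Distinct reduced terms thus map to distinct monomials. -/
lemma eq_zero_of_pairAugmentation_eq_zero {a : Fin n →₀ ℕ} {d : ℕ} (ha : ∀ m ∈ G, m ≤ a)
    (hd : ∀ m ∈ G, m.degree = d) {v : PairModule K n} (hv : v ∈ reducedElements K n)
    (hvalid : v ∈ Finsupp.supported _ (MvPolynomial (Fin n) K) (validPairs G 0))
    (h0 : pairAugmentation K a v = 0) : v = 0 := by
  by_contra hne
  obtain ⟨⟨m, σ⟩, hp⟩ := Finsupp.support_nonempty_iff.2 hne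
  obtain ⟨u, hu⟩ := MvPolynomial.ne_zero_iff.1 (Finsupp.mem_support_iff.1 hp)
  obtain ⟨hm, -, hcard⟩ := hvalid hp
  have hσ : σ = ∅ := Finset.card_eq_zero.1 hcard
  subst hσ
  have hu' := (hv _ _ hu).resolve_left (by simp)
  have h1 : coeff (u + (a - m)) (pairAugmentation K a v) = 0 := by
    rw [h0]; simp
  rw [pairAugmentation, Finsupp.linearCombination_apply, Finsupp.sum, coeff_sum,
    Finset.sum_eq_single_of_mem _ hp] at h1
  · rw [smul_eq_mul, coeff_mul_monomial, mul_one] at h1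
    exact hu h1
  · rintro ⟨m', σ'⟩ hp' hne'
    obtain ⟨hm', -, hcard'⟩ := hvalid hp'
    have hσ' : σ' = ∅ := Finset.card_eq_zero.1 hcard'
    subst hσ'
    rw [smul_eq_mul, coeff_mul_monomial', mul_one]
    split_ifs with hle
    swap
    · rfl
    by_contra hc
    have hc' := (hv _ _ hc).resolve_left (by simp)
    refine hne' ?_
    rw [Prod.mk.injEq]
    refine ⟨(eq_of_forall_ne_zero ((hd m hm).trans (hd m' hm').symm) fun i hi => ?_).symm, rfl⟩
    have h2 := hu'.2 i hi
    have h3 := hc'.2 i hi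
    have h4 := hle i
    have h5 := ha m hm i
    have h6 := ha m' hm' i
    simp only [Finsupp.add_apply, Finsupp.tsub_apply] at *
    omega

/-! ### Exactness -/

lemma exists_pairDifferential_eq (hG : ∀ m ∈ G, ∀ j ∈ supp₁ m, move m {j} ∈ G)
    {v : PairModule K n}
    (hvalid : v ∈ Finsupp.supported _ (MvPolynomial (Fin n) K) (validPairs G (k + 1)))
    (h0 : pairDifferential K n v = 0) :
    ∃ w ∈ Finsupp.supported (MvPolynomial (Fin n) K) (MvPolynomial (Fin n) K)
        (validPairs G (k + 2)), pairDifferential K n w = v := by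
  obtain ⟨w, hw, hred⟩ := exists_sub_mem_reducedElements hG hvalid
  refine ⟨w, hw, (sub_eq_zero.1 (eq_zero_of_pairDifferential_eq_zero hred
    (Submodule.sub_mem _ hvalid (pairDifferential_mem_supported hG hw)) ?_)).symm⟩
  rw [map_sub, h0, pairDifferential_pairDifferential hw, sub_zero]

lemma exists_pairDifferential_eq_of_pairAugmentation {a : Fin n →₀ ℕ} {d : ℕ}
    (ha : ∀ m ∈ G, m ≤ a) (hd : ∀ m ∈ G, m.degree = d)
    (hG : ∀ m ∈ G, ∀ j ∈ supp₁ m, move m {j} ∈ G) {v : PairModule K n}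
    (hvalid : v ∈ Finsupp.supported _ (MvPolynomial (Fin n) K) (validPairs G 0))
    (h0 : pairAugmentation K a v = 0) :
    ∃ w ∈ Finsupp.supported (MvPolynomial (Fin n) K) (MvPolynomial (Fin n) K)
        (validPairs G 1), pairDifferential K n w = v := by
  obtain ⟨w, hw, hred⟩ := exists_sub_mem_reducedElements hG hvalid
  refine ⟨w, hw, (sub_eq_zero.1 (eq_zero_of_pairAugmentation_eq_zero ha hd hred
    (Submodule.sub_mem _ hvalid (pairDifferential_mem_supported hG hw)) ?_)).symm⟩
  rw [map_sub, h0, pairAugmentation_pairDifferential ha hG hw, sub_zero]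

end PairComplex

/-! ## The cellular differential -/

section Differential

variable {K : Type*} [Field K] {n : ℕ} {X : Set (Set (Fin n → ℝ))} {k : ℕ}

lemma finite_cells (hX : X.Finite) (k : ℕ) : Finite (Cells X k) :=
  (hX.subset (fun _ h => h.1 : {P | P ∈ X ∧ cellDim P = (k : ℤ) - 1} ⊆ X)).to_subtype

open Classical in
lemma cellularDifferential_single_apply (hX : X.Finite) (lab : (Fin n → ℝ) → (Fin n →₀ ℕ))
    (ε : Set (Fin n → ℝ) → Set (Fin n → ℝ) → ℤ) (P : Cells X (k + 1))
    (r : MvPolynomial (Fin n) K) (Q : Cells X k) :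
    cellularDifferential K X lab ε k (Finsupp.single P r) Q =
      if IsFacet Q.1 P.1 then
        r * monomial (cellLabel X lab P.1 - cellLabel X lab Q.1) ((ε Q.1 P.1 : ℤ) : K) else 0 := by
  have := finite_cells hX k
  have := Fintype.ofFinite (Cells X k)
  rw [cellularDifferential, Finsupp.linearCombination_single, finsum_eq_sum_of_fintype,
    Finsupp.smul_apply, Finsupp.finsetSum_apply, smul_eq_mul, Finset.sum_eq_single_of_mem Q
    (Finset.mem_univ Q)]
  · split_ifs <;> simp
  · intro Q' _ hQ'
    split_ifs
    · exact Finsupp.single_eq_of_ne' hQ'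
    · rfl

/-- Labels grow with cells, so β - α_P and α_P - α_Q add up to β - α_Q without truncation. -/
lemma isMultihomogeneous_cellularDifferential (hX : X.Finite) (a : Fin n →₀ ℕ)
    (ε : Set (Fin n → ℝ) → Set (Fin n → ℝ) → ℤ) {v : CellularModule K X (k + 1)} {β : Fin n →₀ ℕ}
    (hv : IsMultihomogeneous (dualLabel a) v β) :
    IsMultihomogeneous (dualLabel a) (cellularDifferential K X (dualLabel a) ε k v) β := by
  classical
  intro Q hQ
  have hsum : cellularDifferential K X (dualLabel a) ε k v Q =
      ∑ P ∈ v.support, cellularDifferential K X (dualLabel a) ε k (Finsupp.single P (v P)) Q := by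
    conv_lhs => rw [← Finsupp.sum_single v, Finsupp.sum, map_sum, Finsupp.finsetSum_apply]
  have hterm : ∀ P ∈ v.support,
      cellularDifferential K X (dualLabel a) ε k (Finsupp.single P (v P)) Q ≠ 0 →
        cellLabel X (dualLabel a) Q.1 ≤ β := by
    intro P hP h
    rw [cellularDifferential_single_apply hX] at h
    split_ifs at h with hfac
    · exact (cellLabel_mono X a hfac.1).trans (hv P (Finsupp.mem_support_iff.1 hP)).1
    · exact absurd rfl h
  have hmon : ∀ P ∈ v.support, ∃ c : K,
      cellularDifferential K X (dualLabel a) ε k (Finsupp.single P (v P)) Q =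
        monomial (β - cellLabel X (dualLabel a) Q.1) c := by
    intro P hP
    obtain ⟨hle, c, hc⟩ := hv P (Finsupp.mem_support_iff.1 hP)
    rw [cellularDifferential_single_apply hX]
    split_ifs with hfac
    · rw [hc, monomial_mul, tsub_add_tsub_cancel hle (cellLabel_mono X a hfac.1)]
      exact ⟨_, rfl⟩
    · exact ⟨0, by simp⟩
  rw [hsum] at hQ ⊢
  obtain ⟨P, hP, hne⟩ := Finset.exists_ne_zero_of_sum_ne_zero hQ
  refine ⟨hterm P hP hne, ?_⟩
  choose! c hc using hmon
  exact ⟨∑ P ∈ v.support, c P, by rw [Finset.sum_congr rfl hc, map_sum]⟩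

end Differential

/-! ### Identification of the cellular complex with the complex on pairs -/

section Transfer

variable {K : Type*} [Field K] {n d k : ℕ} {I : Ideal (MvPolynomial (Fin n) K)} {a : Fin n →₀ ℕ}

lemma exists_pair_of_cell (P : Cells (cellComplex I) (k + 1)) :
    ∃ p ∈ validPairs (minGens I) k, P.1 = cell p.1 p.2 := by
  obtain ⟨P, hP, hdim⟩ := P
  rcases hP with rfl | ⟨m, hm, σ, hσ, rfl⟩
  · rw [cellDim_empty] at hdim
    push_cast at hdim
    omega
  · rw [cellDim_cell hσ] at hdim
    push_cast at hdim
    exact ⟨(m, σ), ⟨hm, hσ, by simp only; omega⟩, rfl⟩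

/-- The pair `(m, σ)` of a nonempty cell. -/
noncomputable def pairOfCell (P : Cells (cellComplex I) (k + 1)) :
    (Fin n →₀ ℕ) × Finset (Fin n) :=
  (exists_pair_of_cell P).choose

lemma pairOfCell_mem (P : Cells (cellComplex I) (k + 1)) :
    pairOfCell P ∈ validPairs (minGens I) k :=
  (exists_pair_of_cell P).choose_spec.1

lemma cell_pairOfCell (P : Cells (cellComplex I) (k + 1)) :
    P.1 = cell (pairOfCell P).1 (pairOfCell P).2 :=
  (exists_pair_of_cell P).choose_spec.2

/-- The cell of a pair `(m, σ)`. -/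
def cellOfPair (p : (Fin n →₀ ℕ) × Finset (Fin n)) (hp : p ∈ validPairs (minGens I) k) :
    Cells (cellComplex I) (k + 1) :=
  ⟨cell p.1 p.2, cell_mem_cellComplex hp.1 hp.2.1, by
    rw [cellDim_cell hp.2.1, hp.2.2]
    push_cast
    ring⟩

lemma coe_cellOfPair {p : (Fin n →₀ ℕ) × Finset (Fin n)} (hp : p ∈ validPairs (minGens I) k) :
    (cellOfPair p hp).1 = cell p.1 p.2 := rfl

lemma pairOfCell_eq {P : Cells (cellComplex I) (k + 1)} {p : (Fin n →₀ ℕ) × Finset (Fin n)}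
    (hp : p.2 ⊆ supp₁ p.1) (h : P.1 = cell p.1 p.2) : pairOfCell P = p := by
  obtain ⟨h1, h2⟩ := cell_injective (pairOfCell_mem P).2.1 hp ((cell_pairOfCell P).symm.trans h)
  exact Prod.ext h1 h2

lemma pairOfCell_cellOfPair {p : (Fin n →₀ ℕ) × Finset (Fin n)}
    (hp : p ∈ validPairs (minGens I) k) : pairOfCell (cellOfPair p hp) = p :=
  pairOfCell_eq hp.2.1 rfl

lemma pairOfCell_injective :
    Function.Injective (pairOfCell : Cells (cellComplex I) (k + 1) → _) := by
  intro P Q h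
  apply Subtype.ext
  rw [cell_pairOfCell P, cell_pairOfCell Q, h]

/-- The cellular module as a submodule of the module on pairs. -/
noncomputable def toPairs (I : Ideal (MvPolynomial (Fin n) K)) (k : ℕ) :
    CellularModule K (cellComplex I) (k + 1) →ₗ[MvPolynomial (Fin n) K] PairModule K n :=
  Finsupp.lmapDomain _ _ pairOfCell

lemma toPairs_single (P : Cells (cellComplex I) (k + 1)) (r : MvPolynomial (Fin n) K) :
    toPairs I k (Finsupp.single P r) = Finsupp.single (pairOfCell P) r :=
  Finsupp.mapDomain_single

lemma toPairs_injective : Function.Injective (toPairs I k) :=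
  Finsupp.mapDomain_injective pairOfCell_injective

lemma toPairs_mem_supported (v : CellularModule K (cellComplex I) (k + 1)) :
    toPairs I k v ∈ Finsupp.supported (MvPolynomial (Fin n) K) (MvPolynomial (Fin n) K)
      (validPairs (minGens I) k) := by
  refine map_mem_of_supported (s := Set.univ) _ _ (fun P _ => ?_) (Set.subset_univ _)
  rw [toPairs_single]
  exact Finsupp.single_mem_supported _ _ (pairOfCell_mem P)

lemma exists_toPairs_eq {w : PairModule K n}
    (hw : w ∈ Finsupp.supported _ (MvPolynomial (Fin n) K) (validPairs (minGens I) k)) :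
    ∃ v, toPairs I k v = w := by
  refine LinearMap.mem_range.1 (map_mem_of_supported LinearMap.id _ (fun p hp => ?_) hw)
  refine ⟨Finsupp.single (cellOfPair p hp) 1, ?_⟩
  rw [toPairs_single, pairOfCell_cellOfPair, LinearMap.id_apply]

/-- The index of the variable in the coefficient of a facet in the differential. -/
def facetVar (j : Fin n) (b : Bool) : Fin n := if b then prev j else j

lemma facetBase_mem_validPairs (hstable : IsStronglyStable I) (hdeg : GeneratedInDegree I d)
    {p : (Fin n →₀ ℕ) × Finset (Fin n)} (hp : p ∈ validPairs (minGens I) (k + 1)) {j : Fin n}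
    (hj : j ∈ p.2) (b : Bool) :
    (facetBase p.1 j b, p.2.erase j) ∈ validPairs (minGens I) k := by
  cases b
  · exact erase_mem_validPairs hp hj
  · exact move_mem_validPairs (fun _ h _ hj => step_mem_minGens hstable hdeg h hj) hp hj

/-- Since x^a / (m → j) = (x^a / m) x_j / x_{j-1}, dropping j costs x_j at m and x_{j-1} at m → j.
Every coefficient of a nonempty facet is therefore ± one variable. -/
lemma cellLabel_facetBase (hstable : IsStronglyStable I) (hdeg : GeneratedInDegree I d)
    (hdet : IsDetermined I a) {p : (Fin n →₀ ℕ) × Finset (Fin n)}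
    (hp : p ∈ validPairs (minGens I) (k + 1)) {j : Fin n} (hj : j ∈ p.2) (b : Bool) :
    cellLabel (cellComplex I) (dualLabel a) (cell p.1 p.2) =
      cellLabel (cellComplex I) (dualLabel a) (cell (facetBase p.1 j b) (p.2.erase j)) +
        Finsupp.single (facetVar j b) 1 := by
  obtain ⟨h1, h2, -⟩ := facetBase_mem_validPairs hstable hdeg hp hj b
  rw [cellLabel_cell hstable hdeg hdet hp.1 hp.2.1, cellLabel_cell hstable hdeg hdet h1 h2,
    ← Finset.sum_erase_add _ _ hj, ← add_assoc]
  cases b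
  · rfl
  · have h3 := step_add (hp.2.1 hj)
    simp only [facetBase, facetVar, if_true] at h1 ⊢
    rw [add_right_comm, add_right_comm (a - move p.1 {j})]
    congr 1
    ext i
    have h4 := DFunLike.congr_fun h3 i
    have h5 := hdet _ hp.1 i
    have h6 := hdet _ h1 i
    simp only [Finsupp.add_apply, Finsupp.tsub_apply] at *
    omega

/-- The nonempty facets of P correspond bijectively to (j, b) with j ∈ σ, which turns the sum over
cells into the explicit formula. Exactness is carried over along this identity. -/
lemma toPairs_cellularDifferential (hstable : IsStronglyStable I) (hdeg : GeneratedInDegree I d)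
    (hdet : IsDetermined I a) (v : CellularModule K (cellComplex I) (k + 2)) :
    toPairs I k (cellularDifferential K (cellComplex I) (dualLabel a) incidence (k + 1) v) =
      pairDifferential K n (toPairs I (k + 1) v) := by
  classical
  have hfin := finite_cells (finite_cellComplex hdet) (k + 1)
  have := Fintype.ofFinite (Cells (cellComplex I) (k + 1))
  suffices h : toPairs I k ∘ₗ
      cellularDifferential K (cellComplex I) (dualLabel a) incidence (k + 1) =
      pairDifferential K n ∘ₗ toPairs I (k + 1) from LinearMap.congr_fun h v
  ext1 P
  apply LinearMap.ext_ring
  simp only [LinearMap.comp_apply, Finsupp.lsingle_apply]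
  have hP := pairOfCell_mem P
  have hPc := cell_pairOfCell P
  rw [toPairs_single]
  set p := pairOfCell P with hp
  rw [pairDifferential_single, ← Finset.sum_coe_sort, cellularDifferential,
    Finsupp.linearCombination_single, one_smul, finsum_eq_sum_of_fintype]
  have hsum : ∑ x : p.2 × Bool, Finsupp.single
        (cellOfPair (facetBase p.1 x.1 x.2, p.2.erase x.1)
          (facetBase_mem_validPairs hstable hdeg hP x.1.2 x.2))
        (monomial (Finsupp.single (facetVar (x.1 : Fin n) x.2) 1)
          ((facetSign x.2 * koszulSign p.2 x.1 : ℤ) : K)) =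
      ∑ Q : Cells (cellComplex I) (k + 1), if IsFacet Q.1 P.1 then
        Finsupp.single Q (monomial (cellLabel (cellComplex I) (dualLabel a) P.1 -
          cellLabel (cellComplex I) (dualLabel a) Q.1) ((incidence Q.1 P.1 : ℤ) : K)) else 0 := by
    refine Finset.sum_of_injOn (fun x : p.2 × Bool =>
        cellOfPair (facetBase p.1 x.1 x.2, p.2.erase x.1)
          (facetBase_mem_validPairs hstable hdeg hP x.1.2 x.2)) ?_ (fun _ _ => Finset.mem_univ _)
      ?_ ?_
    · rintro ⟨⟨j, hj⟩, b⟩ - ⟨⟨j', hj'⟩, b'⟩ - h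
      obtain ⟨h1, h2⟩ := facetBase_cell_injective hP.2.1 hj hj' (congrArg Subtype.val h)
      subst h1 h2
      rfl
    · intro Q _ hQ
      rw [if_neg]
      intro hfac
      have hQc := cell_pairOfCell Q
      rw [hPc, hQc] at hfac
      obtain ⟨j, hj, b, h1, h2⟩ := exists_facetBase_of_isFacet hP.2.1 (pairOfCell_mem Q).2.1 hfac
      refine hQ ⟨(⟨j, hj⟩, b), by simp, Subtype.ext ?_⟩
      rw [hQc, h1, h2]
      rfl
    · rintro ⟨⟨j, hj⟩, b⟩ -
      have h1 := isFacet_facetBase hP.2.1 hj b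
      have h2 := cellLabel_facetBase hstable hdeg hdet hP hj b
      have h3 := incidence_facetBase hP.2.1 hj b
      dsimp only
      rw [hPc, coe_cellOfPair, if_pos h1, h3, h2, add_tsub_cancel_left]
  rw [← hsum, map_sum, Fintype.sum_prod_type]
  refine Finset.sum_congr rfl fun j _ => ?_
  rw [Fintype.sum_bool, toPairs_single, toPairs_single, pairOfCell_cellOfPair,
    pairOfCell_cellOfPair]
  simp only [facetSign, facetBase, facetVar, if_true, Bool.false_eq_true, if_false, one_mul]
  rcases koszulSign_eq_one_or p.2 j with h | h <;> rw [h] <;> simp [X, sub_eq_add_neg, add_comm]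

/-! ### The empty cell -/

variable (I) in
/-- The empty cell. -/
def emptyCell : Cells (cellComplex I) 0 :=
  ⟨∅, empty_mem_cellComplex, by rw [cellDim_empty]; rfl⟩

lemma eq_emptyCell (P : Cells (cellComplex I) 0) : P = emptyCell I := by
  apply Subtype.ext
  obtain ⟨P, rfl | ⟨m, hm, σ, hσ, rfl⟩, hdim⟩ := P
  · rfl
  · rw [cellDim_cell hσ] at hdim
    exact absurd hdim (by push_cast; omega)

variable (I) in
/-- The coefficient of the empty cell. -/
noncomputable def emptyCoeff :
    CellularModule K (cellComplex I) 0 →ₗ[MvPolynomial (Fin n) K] MvPolynomial (Fin n) K :=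
  Finsupp.lapply (emptyCell I)

lemma emptyCoeff_injective : Function.Injective (emptyCoeff I) := by
  intro v w h
  ext1 P
  rw [eq_emptyCell P]
  exact h

lemma cellularAugmentation_eq (J : Ideal (MvPolynomial (Fin n) K))
    (v : CellularModule K (cellComplex I) 0) :
    cellularAugmentation K (cellComplex I) J v = Ideal.Quotient.mk J (emptyCoeff I v) := by
  have hv : v = Finsupp.single (emptyCell I) (emptyCoeff I v) := by
    apply emptyCoeff_injective
    simp [emptyCoeff]
  rw [hv, cellularAugmentation, Finsupp.linearCombination_single, ← hv]
  change Ideal.Quotient.mk J (emptyCoeff I v • 1) = _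
  rw [smul_eq_mul, mul_one]

lemma emptyCoeff_cellularDifferential (hstable : IsStronglyStable I)
    (hdeg : GeneratedInDegree I d) (hdet : IsDetermined I a)
    (v : CellularModule K (cellComplex I) 1) :
    emptyCoeff I (cellularDifferential K (cellComplex I) (dualLabel a) incidence 0 v) =
      pairAugmentation K a (toPairs I 0 v) := by
  suffices h : emptyCoeff I ∘ₗ
      cellularDifferential K (cellComplex I) (dualLabel a) incidence 0 =
      pairAugmentation K a ∘ₗ toPairs I 0 from LinearMap.congr_fun h v
  ext1 P
  apply LinearMap.ext_ring
  simp only [LinearMap.comp_apply, Finsupp.lsingle_apply]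
  have hP := pairOfCell_mem P
  have hσ : (pairOfCell P).2 = ∅ := Finset.card_eq_zero.1 hP.2.2
  have hfac : IsFacet (emptyCell I).1 P.1 := by
    rw [cell_pairOfCell P]
    exact (isFacet_empty_cell_iff hP.2.1).2 hσ
  rw [toPairs_single, pairAugmentation, Finsupp.linearCombination_single, one_smul, emptyCoeff,
    Finsupp.lapply_apply, cellularDifferential_single_apply (finite_cellComplex hdet),
    if_pos hfac, one_mul]
  change monomial (_ - cellLabel _ _ ∅) ((incidence ∅ P.1 : ℤ) : K) = _
  rw [cellLabel_empty, incidence_empty (by simpa using P.2.2), cell_pairOfCell P,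
    cellLabel_cell hstable hdeg hdet hP.1 hP.2.1, hσ]
  simp

/-! ### The resolution -/

lemma isFreeResolution_cellular (hstable : IsStronglyStable I) (hdeg : GeneratedInDegree I d)
    (hdet : IsDetermined I a) :
    IsFreeResolution (cellularDifferential K (cellComplex I) (dualLabel a) incidence)
      (cellularAugmentation K (cellComplex I) (dualIdeal I a)) where
  free k := inferInstance
  finite k := by
    have := finite_cells (finite_cellComplex hdet) k
    infer_instance
  exact_succ k := by
    have hG : ∀ m ∈ minGens I, ∀ j ∈ supp₁ m, move m {j} ∈ minGens I :=
      fun _ h _ hj => step_mem_minGens hstable hdeg h hj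
    intro v
    -- At the vertices the outgoing map goes to the empty cell and becomes `pairAugmentation`; in
    -- higher degrees both maps become `pairDifferential`.
    cases k with
    | zero =>
      constructor
      · intro hv
        have h0 : pairAugmentation K a (toPairs I 0 v) = 0 := by
          rw [← emptyCoeff_cellularDifferential hstable hdeg hdet, hv, map_zero]
        obtain ⟨w, hw, hwv⟩ := exists_pairDifferential_eq_of_pairAugmentation hdet hdeg hG
          (toPairs_mem_supported v) h0
        obtain ⟨w', rfl⟩ := exists_toPairs_eq hw
        refine ⟨w', toPairs_injective ?_⟩
        rw [toPairs_cellularDifferential hstable hdeg hdet, hwv]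
      · rintro ⟨w, rfl⟩
        apply emptyCoeff_injective
        rw [emptyCoeff_cellularDifferential hstable hdeg hdet,
          toPairs_cellularDifferential hstable hdeg hdet, map_zero,
          pairAugmentation_pairDifferential hdet hG (toPairs_mem_supported w)]
    | succ k =>
      constructor
      · intro hv
        have h0 : pairDifferential K n (toPairs I (k + 1) v) = 0 := by
          rw [← toPairs_cellularDifferential hstable hdeg hdet, hv, map_zero]
        obtain ⟨w, hw, hwv⟩ := exists_pairDifferential_eq hG (toPairs_mem_supported v) h0
        obtain ⟨w', rfl⟩ := exists_toPairs_eq hw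
        refine ⟨w', toPairs_injective ?_⟩
        rw [toPairs_cellularDifferential hstable hdeg hdet, hwv]
      · rintro ⟨w, rfl⟩
        apply toPairs_injective
        rw [toPairs_cellularDifferential hstable hdeg hdet,
          toPairs_cellularDifferential hstable hdeg hdet, map_zero,
          pairDifferential_pairDifferential (toPairs_mem_supported w)]
  exact_zero := by
    intro v
    rw [cellularAugmentation_eq, Ideal.Quotient.eq_zero_iff_mem]
    constructor
    · intro hv
      have hle : dualIdeal I a ≤ LinearMap.range (emptyCoeff I ∘ₗ
          cellularDifferential K (cellComplex I) (dualLabel a) incidence 0) := by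
        rw [dualIdeal, Ideal.span_le]
        rintro _ ⟨m, hm, rfl⟩
        have hp : (m, ∅) ∈ validPairs (minGens I) 0 := ⟨hm, Finset.empty_subset _, rfl⟩
        refine ⟨Finsupp.single (cellOfPair (m, ∅) hp) 1, ?_⟩
        rw [LinearMap.comp_apply, emptyCoeff_cellularDifferential hstable hdeg hdet,
          toPairs_single, pairOfCell_cellOfPair, pairAugmentation,
          Finsupp.linearCombination_single, one_smul]
      obtain ⟨w, hw⟩ := hle hv
      exact ⟨w, emptyCoeff_injective hw⟩
    · rintro ⟨w, rfl⟩
      rw [emptyCoeff_cellularDifferential hstable hdeg hdet]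
      refine map_mem_of_supported _ (dualIdeal I a) (fun p hp => ?_) (toPairs_mem_supported w)
      rw [pairAugmentation, Finsupp.linearCombination_single, one_smul]
      exact Ideal.subset_span ⟨p.1, hp.1, rfl⟩
  surjective := by
    intro x
    obtain ⟨r, rfl⟩ := Ideal.Quotient.mk_surjective x
    refine ⟨Finsupp.single (emptyCell I) r, ?_⟩
    rw [cellularAugmentation_eq]
    simp [emptyCoeff]

/-! ### Minimality -/

lemma monomial_mem_span_range_X {u : Fin n →₀ ℕ} (hu : u ≠ 0) (c : K) :
    monomial u c ∈ Ideal.span (Set.range (X : Fin n → MvPolynomial (Fin n) K)) := by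
  obtain ⟨i, hi⟩ := Finsupp.ne_iff.1 hu
  have h : Finsupp.single i 1 + (u - Finsupp.single i 1) = u :=
    add_tsub_cancel_of_le (Finsupp.single_le_iff.2 (Nat.one_le_iff_ne_zero.2 hi))
  rw [← h, monomial_single_add, pow_one]
  exact Ideal.mul_mem_right _ _ (Ideal.subset_span ⟨i, rfl⟩)

/-- For a nonempty facet the difference is the exponent of one variable. For the empty facet it is
that of x^a / m; were it zero, 1 would be a generator of the dual ideal. -/
lemma cellLabel_sub_ne_zero (hstable : IsStronglyStable I) (hdeg : GeneratedInDegree I d)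
    (hdet : IsDetermined I a) (htop : dualIdeal I a ≠ ⊤) {P Q : Set (Fin n → ℝ)}
    (hP : P ∈ cellComplex I) (hQ : Q ∈ cellComplex I) (h : IsFacet Q P) :
    cellLabel (cellComplex I) (dualLabel a) P - cellLabel (cellComplex I) (dualLabel a) Q ≠ 0 := by
  obtain ⟨m, hm, σ, hσ, rfl⟩ := exists_cell_of_mem_of_isFacet hP h
  rcases hQ with rfl | ⟨m', -, σ', hσ', rfl⟩
  · rw [isFacet_empty_cell_iff hσ] at h
    subst h
    rw [cellLabel_empty, tsub_zero, cellLabel_cell hstable hdeg hdet hm hσ, Finset.sum_empty,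
      add_zero]
    intro h0
    refine htop ((Ideal.eq_top_iff_one _).2 (Ideal.subset_span ⟨m, hm, ?_⟩))
    simp only [h0]
    rfl
  · obtain ⟨j, hj, b, rfl, rfl⟩ := exists_facetBase_of_isFacet hσ hσ' h
    have hp : (m, σ) ∈ validPairs (minGens I) ((σ.card - 1) + 1) :=
      ⟨hm, hσ, (Nat.sub_add_cancel (Finset.card_pos.2 ⟨j, hj⟩)).symm⟩
    rw [cellLabel_facetBase hstable hdeg hdet hp hj b, add_tsub_cancel_left]
    simp

lemma isMinimalComplex_cellular (hstable : IsStronglyStable I) (hdeg : GeneratedInDegree I d)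
    (hdet : IsDetermined I a) (htop : dualIdeal I a ≠ ⊤) :
    IsMinimalComplex (cellularDifferential K (cellComplex I) (dualLabel a) incidence) := by
  classical
  rintro k _ ⟨v, rfl⟩
  refine map_mem_of_supported (s := Set.univ) _ _ (fun P _ => ?_) (Set.subset_univ _)
  rw [← Finsupp.sum_single (cellularDifferential K (cellComplex I) (dualLabel a) incidence k
    (Finsupp.single P 1))]
  refine Submodule.sum_mem _ fun Q _ => ?_
  rw [← mul_one (cellularDifferential K (cellComplex I) (dualLabel a) incidence k
    (Finsupp.single P 1) Q), ← smul_eq_mul, ← Finsupp.smul_single]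
  refine Submodule.smul_mem_smul ?_ Submodule.mem_top
  rw [cellularDifferential_single_apply (finite_cellComplex hdet)]
  split_ifs with hfac
  · rw [one_mul]
    exact monomial_mem_span_range_X
      (cellLabel_sub_ne_zero hstable hdeg hdet htop P.2.1 Q.2.1 hfac) _
  · exact Ideal.zero_mem _

end Transfer

end CellularDual

theorem theorem5 {K : Type*} [Field K] (n d : ℕ) (a : Fin n →₀ ℕ)
    (I : Ideal (MvPolynomial (Fin n) K))
    (hmon : IsMonomialIdeal I) (hstable : IsStronglyStable I)
    (hdeg : GeneratedInDegree I d) (hdet : IsDetermined I a) :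
    -- `X_I` is a polyhedral cell complex
    IsPolyhedralComplex (cellComplex I) ∧
    -- its nonempty cells are the `|σ|`-dimensional polytopes `C(m, σ)`, which are pairwise distinct,
    -- have their corners in `G(I)`, and carry the labels `(x^a / m) x^σ`
    (∀ m ∈ minGens I, ∀ σ ⊆ supp₁ m,
      (∀ τ ⊆ σ, move m τ ∈ minGens I) ∧
      cellDim (cell m σ) = (σ.card : ℤ) ∧
      cellLabel (cellComplex I) (dualLabel a) (cell m σ) =
        (a - m) + ∑ j ∈ σ, Finsupp.single j 1) ∧
    (∀ m ∈ minGens I, ∀ σ ⊆ supp₁ m, ∀ m' ∈ minGens I, ∀ σ' ⊆ supp₁ m',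
      cell m σ = cell m' σ' → m = m' ∧ σ = σ') ∧
    -- the explicit signs form an incidence function
    IsIncidenceFunction (cellComplex I) incidence ∧
    -- the cellular complex is a multigraded free resolution of `R / Î`
    IsFreeResolution
      (cellularDifferential K (cellComplex I) (dualLabel a) incidence)
      (cellularAugmentation K (cellComplex I) (dualIdeal I a)) ∧
    (∀ (k : ℕ) (v : CellularModule K (cellComplex I) (k + 1)) (β : Fin n →₀ ℕ),
      IsMultihomogeneous (dualLabel a) v β →
        IsMultihomogeneous (dualLabel a)
          (cellularDifferential K (cellComplex I) (dualLabel a) incidence k v) β) ∧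
    -- and it is minimal (if `Î` is the unit ideal, the resolved module is zero)
    (dualIdeal I a ≠ ⊤ →
      IsMinimalComplex (cellularDifferential K (cellComplex I) (dualLabel a) incidence)) := by
  refine ⟨isPolyhedralComplex_cellComplex hstable hdeg hdet,
    fun m hm σ hσ => ⟨fun τ hτ => move_mem_minGens hstable hdeg hm (hτ.trans hσ),
      cellDim_cell hσ, cellLabel_cell hstable hdeg hdet hm hσ⟩,
    fun m _ σ hσ m' _ σ' hσ' h => cell_injective hσ hσ' h,
    isIncidenceFunction_incidence,
    isFreeResolution_cellular hstable hdeg hdet,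
    fun k v β hv => isMultihomogeneous_cellularDifferential (finite_cellComplex hdet) a _ hv,
    isMinimalComplex_cellular hstable hdeg hdet⟩
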